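/- Let $G$ be a locally compact Hausdorff group with a fixed left Haar measure $|\cdot|$ (a regular Borel measure). A set $E\subseteq G$ is locally null if $|E\cap K|=0$ for every compact $K\subseteq G$, and $\phi:G\to\mathbb C$ is locally measurable if $\phi\mathbf 1_K$ is measurable for every compact $K\subseteq G$. Let $L_\infty(G)$ be the space of bounded locally measurable functions $G\to\mathbb C$ modulo equality off locally null sets. A mean on $L_\infty(G)$ is a linear functional $m$ with $m(1)=1$ and $m(\phi)\ge 0$ for all $\phi\ge 0$. The group $G$ is amenable if there is a mean $m$ on $L_\infty(G)$ with $m(\phi-l_x\phi)=0$ for all $\phi\in L_\infty(G)$ and $x\in G$, where $l_x\phi(y)=\phi(x^{-1}y)$. Let $P_1(G)=\{f\in L_1(G): f\ge 0,\ \int_G f=1\}$. For $f\in L_1(G)$ and $\phi\in L_\infty(G)$ put $(f*\phi)(x)=\int_G f(y)\,\phi(y^{-1}x)\,dy$ and $(\phi f)(t)=\int_G f(t^{-1}y)\,\phi(y)\,dy$. Let $\mathrm{TLIM}(G)$ (topological left-invariant means) be the set of means $m$ on $L_\infty(G)$ with $m(\phi-f*\phi)=0$ for all $\phi\in L_\infty(G)$,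 $f\in P_1(G)$, and let $\mathrm{TIM}(G)$ (topological two-sided invariant means) be the set of those $m\in\mathrm{TLIM}(G)$ that in addition satisfy $m(\phi-\phi f)=0$ for all $\phi\in L_\infty(G)$, $f\in P_1(G)$. Theorem. Let $G$ be an amenable locally compact Hausdorff group, and let $\kappa$ be the least cardinality of a cover of $G$ by compact subsets. If $\kappa>1$, then $$|\mathrm{TIM}(G)|=|\mathrm{TLIM}(G)|=2^{2^{\kappa}}.$$ -/

import Mathlib

open MeasureTheory Filter Topology
open scoped ComplexOrder Cardinal

set_option linter.unusedSectionVars false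

namespace TopInvMean

noncomputable section

section Basic

variable (G : Type*) [Group G] [TopologicalSpace G] [MeasurableSpace G]

/-- `κ(G)`: the least cardinality of a family of compact subsets covering `G`. -/
def compactCoveringNumber (G : Type*) [TopologicalSpace G] : Cardinal :=
  sInf {c : Cardinal | ∃ 𝒦 : Set (Set G), (∀ K ∈ 𝒦, IsCompact K) ∧ ⋃₀ 𝒦 = Set.univ ∧ #𝒦 = c}

/-- `φ` is locally measurable if `φ · 1_K` is (Borel) measurable for every compact `K`. -/
def IsLocallyMeasurable {G : Type*} [TopologicalSpace G] [MeasurableSpace G] (φ : G → ℂ) : Prop :=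
  ∀ K : Set G, IsCompact K → Measurable (K.indicator φ)

/-- The space of bounded locally measurable functions `G → ℂ`, before passing to classes. -/
def BoundedLM : Submodule ℂ (G → ℂ) where
  carrier := {φ | IsLocallyMeasurable φ ∧ ∃ C : ℝ, ∀ x, ‖φ x‖ ≤ C}
  zero_mem' := by
    refine ⟨fun K _ => ?_, 0, by simp⟩
    simp only [Set.indicator_zero']
    exact measurable_const
  add_mem' := by
    rintro φ ψ ⟨hφ, C, hC⟩ ⟨hψ, D, hD⟩
    refine ⟨fun K hK => ?_, C + D, fun x => (norm_add_le _ _).trans (add_le_add (hC x) (hD x))⟩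
    rw [Set.indicator_add']
    exact (hφ K hK).add (hψ K hK)
  smul_mem' := by
    rintro c φ ⟨hφ, C, hC⟩
    refine ⟨fun K hK => ?_, ‖c‖ * C, fun x => ?_⟩
    · have h : K.indicator (c • φ) = c • K.indicator φ := Set.indicator_const_smul K c φ
      rw [h]
      exact (hφ K hK).const_smul c
    · simpa using mul_le_mul_of_nonneg_left (hC x) (norm_nonneg c)

end Basic

variable {G : Type*} [Group G] [TopologicalSpace G] [IsTopologicalGroup G] [T2Space G]
  [LocallyCompactSpace G] [MeasurableSpace G] [BorelSpace G]

/-- `E` is locally null if `|E ∩ K| = 0` for every compact `K`, where `|·|` is left Haar measure. -/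
def IsLocallyNull (E : Set G) : Prop :=
  ∀ K : Set G, IsCompact K → Measure.haar (E ∩ K) = 0

lemma IsLocallyNull.mono {E F : Set G} (hF : IsLocallyNull F) (h : E ⊆ F) : IsLocallyNull E :=
  fun K hK => measure_mono_null (Set.inter_subset_inter_left K h) (hF K hK)

variable (G) in
/-- The functions in `BoundedLM G` that vanish off a locally null set. -/
def locallyNullFunctions : Submodule ℂ (BoundedLM G) where
  carrier := {φ | IsLocallyNull {x | (φ : G → ℂ) x ≠ 0}}
  zero_mem' := fun K _ => by simp
  add_mem' := by
    intro φ ψ hφ hψ K hK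
    refine measure_mono_null ?_ (measure_union_null (hφ K hK) (hψ K hK))
    rintro x ⟨hx, hxK⟩
    by_cases h : (φ : G → ℂ) x = 0
    · refine Or.inr ⟨fun h' => hx ?_, hxK⟩
      simp [h, h']
    · exact Or.inl ⟨h, hxK⟩
  smul_mem' := by
    intro c φ hφ
    refine IsLocallyNull.mono hφ ?_
    intro x hx h
    exact hx (by simp [h])

variable (G) in
/-- `L_∞(G)`: bounded locally measurable functions modulo locally null sets. -/
abbrev Linfty := BoundedLM G ⧸ locallyNullFunctions G

/-- The class in `L_∞(G)` of a bounded locally measurable function. -/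
def toLinfty : BoundedLM G →ₗ[ℂ] Linfty G := (locallyNullFunctions G).mkQ

variable (G) in
/-- The constant function `1`. -/
def oneLM : BoundedLM G :=
  ⟨fun _ => 1, fun K hK => measurable_const.indicator hK.measurableSet, 1, by simp⟩

/-- A mean on `L_∞(G)`: a unital positive linear functional. -/
def IsMean (m : Linfty G →ₗ[ℂ] ℂ) : Prop :=
  m (toLinfty (oneLM G)) = 1 ∧
    ∀ φ : BoundedLM G, IsLocallyNull {x | ¬ 0 ≤ (φ : G → ℂ) x} → 0 ≤ m (toLinfty φ)

/-- The left translate `l_x φ (y) = φ (x⁻¹ y)`. -/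
def leftTranslate (x : G) (φ : BoundedLM G) : BoundedLM G :=
  ⟨fun y => (φ : G → ℂ) (x⁻¹ * y), by
    refine ⟨fun K hK => ?_, φ.2.2.imp fun C hC y => hC _⟩
    have hK' : IsCompact ((fun y => x⁻¹ * y) '' K) := hK.image (continuous_const_mul x⁻¹)
    have h := (φ.2.1 _ hK').comp (measurable_const_mul x⁻¹)
    convert h using 1
    funext y
    have hy : (x⁻¹ * y ∈ (fun y => x⁻¹ * y) '' K) ↔ y ∈ K :=
      (mul_right_injective x⁻¹).mem_set_image
    by_cases h : y ∈ K
    · rw [Set.indicator_of_mem h, Function.comp_apply, Set.indicator_of_mem (hy.2 h)]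
    · rw [Set.indicator_of_notMem h, Function.comp_apply,
        Set.indicator_of_notMem (fun h' => h (hy.1 h'))]⟩

variable (G) in
/-- `G` is amenable: `L_∞(G)` admits a left-invariant mean. -/
def IsAmenable : Prop :=
  ∃ m : Linfty G →ₗ[ℂ] ℂ, IsMean m ∧
    ∀ (φ : BoundedLM G) (x : G), m (toLinfty (φ - leftTranslate x φ)) = 0

variable (G) in
/-- `P_1(G)`: the nonnegative `f ∈ L_1(G)` with `∫ f = 1`. -/
def P1 : Set (Lp ℂ 1 (Measure.haar : Measure G)) :=
  {f | (∀ᵐ x ∂(Measure.haar : Measure G), 0 ≤ f x) ∧ ∫ x, f x ∂Measure.haar = 1}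

/-! Integrating an `L_1` function against a bounded locally measurable one. -/

lemma integrable_coe (f : Lp ℂ 1 (Measure.haar : Measure G)) : Integrable f Measure.haar :=
  L1.integrable_coeFn f

/-- An integrable function vanishes almost everywhere off some σ-compact set. -/
lemma exists_sigmaCompact (f : Lp ℂ 1 (Measure.haar : Measure G)) :
    ∃ S : Set G, IsSigmaCompact S ∧ ∀ᵐ x ∂(Measure.haar : Measure G), x ∉ S → f x = 0 := by
  have hf := integrable_coe f
  have hfm : Measurable f := (Lp.stronglyMeasurable f).measurable
  set A : ℕ → Set G := fun n => {x | ((n : ℝ) + 1)⁻¹ ≤ ‖f x‖} with hA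
  have hAm : ∀ n, MeasurableSet (A n) := fun n => measurableSet_le measurable_const hfm.norm
  have hAf : ∀ n, (Measure.haar : Measure G) (A n) ≠ ⊤ := fun n =>
    (hf.measure_norm_ge_lt_top (by positivity)).ne
  choose K hKA hK hKlt using fun p : ℕ × ℕ =>
    (hAm p.1).exists_isCompact_sdiff_lt (hAf p.1) (ε := ((p.2 : ENNReal) + 1)⁻¹) (by simp)
  refine ⟨⋃ p, K p, isSigmaCompact_iUnion _ fun p => (hK p).isSigmaCompact, ?_⟩
  have hnull : ∀ n, (Measure.haar : Measure G) (A n \ ⋃ p, K p) = 0 := by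
    intro n
    refine le_antisymm ?_ zero_le
    refine ge_of_tendsto' (x := atTop) (f := fun k : ℕ => ((k : ENNReal) + 1)⁻¹) ?_ fun k => ?_
    · have := ENNReal.tendsto_inv_nat_nhds_zero.comp (tendsto_add_atTop_nat 1)
      simpa [Function.comp_def] using this
    · exact (measure_mono (Set.sdiff_subset_sdiff_right
        (Set.subset_iUnion K (n, k)))).trans (hKlt (n, k)).le
  have hall : ∀ᵐ x ∂(Measure.haar : Measure G), ∀ n, x ∉ A n \ ⋃ p, K p :=
    ae_all_iff.2 fun n => measure_eq_zero_iff_ae_notMem.1 (hnull n)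
  filter_upwards [hall] with x hx hxS
  by_contra h0
  obtain ⟨n, hn⟩ := exists_nat_one_div_lt (norm_pos_iff.2 h0)
  refine hx n ⟨?_, hxS⟩
  simpa [hA, one_div] using hn.le

lemma measurable_indicator_of_sigmaCompact {φ : G → ℂ} (hφ : IsLocallyMeasurable φ) {S : Set G}
    (hS : IsSigmaCompact S) : Measurable (S.indicator φ) := by
  obtain ⟨K, hK, rfl⟩ := hS
  have hacc : ∀ n, IsCompact (Set.accumulate K n) := fun n => by
    rw [Set.accumulate_def]
    exact (Set.finite_Iic n).isCompact_biUnion fun i _ => hK i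
  refine measurable_of_tendsto_metrizable (fun n => hφ _ (hacc n)) ?_
  rw [tendsto_pi_nhds]
  intro x
  have := Set.monotone_accumulate (s := K) |>.tendsto_indicator (f := φ) (a := x)
  rw [Set.iUnion_accumulate] at this
  exact this.mono_right (pure_le_nhds _)

lemma aestronglyMeasurable_mul (f : Lp ℂ 1 (Measure.haar : Measure G)) (φ : BoundedLM G) :
    AEStronglyMeasurable (fun x => f x * (φ : G → ℂ) x) Measure.haar := by
  obtain ⟨S, hS, h⟩ := exists_sigmaCompact f
  have h1 : AEStronglyMeasurable (fun x => f x * S.indicator (φ : G → ℂ) x) Measure.haar :=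
    (integrable_coe f).1.mul
      (measurable_indicator_of_sigmaCompact φ.2.1 hS).aestronglyMeasurable
  refine h1.congr ?_
  filter_upwards [h] with x hx
  by_cases hxS : x ∈ S
  · simp [hxS]
  · simp [hx hxS]

/-- `f φ` is integrable for `f ∈ L_1(G)` and `φ` bounded and locally measurable. -/
lemma integrable_mul (f : Lp ℂ 1 (Measure.haar : Measure G)) (φ : BoundedLM G) :
    Integrable (fun x => f x * (φ : G → ℂ) x) Measure.haar := by
  obtain ⟨C, hC⟩ := φ.2.2
  refine ((integrable_coe f).norm.mul_const C).mono' (aestronglyMeasurable_mul f φ) ?_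
  refine Eventually.of_forall fun x => ?_
  simpa using mul_le_mul_of_nonneg_left (hC x) (norm_nonneg _)

/-- The pairing `⟨f, φ⟩ = ∫ f φ`. -/
def pairing (f : Lp ℂ 1 (Measure.haar : Measure G)) (φ : BoundedLM G) : ℂ :=
  ∫ x, f x * (φ : G → ℂ) x ∂Measure.haar

lemma norm_pairing_le (f : Lp ℂ 1 (Measure.haar : Measure G)) (φ : BoundedLM G) {C : ℝ}
    (hC : ∀ x, ‖(φ : G → ℂ) x‖ ≤ C) : ‖pairing f φ‖ ≤ ‖f‖ * C := by
  rw [L1.norm_eq_integral_norm, ← integral_mul_const]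
  refine (norm_integral_le_integral_norm _).trans ?_
  refine integral_mono (integrable_mul f φ).norm ((integrable_coe f).norm.mul_const C) fun x => ?_
  simpa using mul_le_mul_of_nonneg_left (hC x) (norm_nonneg _)

lemma continuous_pairing (φ : BoundedLM G) :
    Continuous fun f : Lp ℂ 1 (Measure.haar : Measure G) => pairing f φ := by
  obtain ⟨C, hC⟩ := φ.2.2
  have hsub : ∀ f g, pairing f φ - pairing g φ = pairing (f - g) φ := by
    intro f g
    unfold pairing
    rw [← integral_sub (integrable_mul f φ) (integrable_mul g φ)]
    refine integral_congr_ae ?_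
    filter_upwards [Lp.coeFn_sub f g] with x hx
    rw [hx, Pi.sub_apply, sub_mul]
  rw [continuous_iff_continuousAt]
  intro g
  rw [ContinuousAt, tendsto_iff_norm_sub_tendsto_zero]
  have h0 : Tendsto (fun f => ‖f - g‖ * C) (𝓝 g) (𝓝 0) := by
    have := (((continuous_id.sub continuous_const).norm).mul_const C).tendsto' g
      (0 : ℝ) (by simp : ‖id g - g‖ * C = 0)
    simpa using this
  refine squeeze_zero (fun _ => norm_nonneg _) (fun f => ?_) h0
  rw [hsub]
  exact norm_pairing_le _ φ hC

/-- The reflection `y ↦ φ (y⁻¹)`. -/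
def reflect (φ : BoundedLM G) : BoundedLM G :=
  ⟨fun y => (φ : G → ℂ) y⁻¹, by
    refine ⟨fun K hK => ?_, φ.2.2.imp fun C hC y => hC _⟩
    have h := (φ.2.1 _ hK.inv).comp measurable_inv
    convert h using 1
    funext y
    have hy : y⁻¹ ∈ K⁻¹ ↔ y ∈ K := Set.inv_mem_inv
    by_cases h : y ∈ K
    · rw [Set.indicator_of_mem h, Function.comp_apply, Set.indicator_of_mem (hy.2 h)]
    · rw [Set.indicator_of_notMem h, Function.comp_apply,
        Set.indicator_of_notMem (fun h' => h (hy.1 h'))]⟩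

lemma mem_boundedLM_of_continuous {φ : G → ℂ} (h : Continuous φ) (hb : ∃ C : ℝ, ∀ x, ‖φ x‖ ≤ C) :
    φ ∈ BoundedLM G :=
  ⟨fun _ hK => h.measurable.indicator hK.measurableSet, hb⟩

/-- `∫ f(ty) φ(y) dy = ⟨g, φ⟩`, where `g` is the translate of `f` in `L_1(G)`. -/
lemma integral_translate (f : Lp ℂ 1 (Measure.haar : Measure G)) (φ : BoundedLM G) (t : G) :
    ∫ y, f (t * y) * (φ : G → ℂ) y ∂Measure.haar = pairing (DomMulAct.mk t • f) φ := by
  refine integral_congr_ae ?_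
  filter_upwards [DomMulAct.smul_Lp_ae_eq (DomMulAct.mk t) f] with y hy
  rw [hy]
  simp

lemma continuous_integral_translate (f : Lp ℂ 1 (Measure.haar : Measure G)) (φ : BoundedLM G) :
    Continuous fun t : G => ∫ y, f (t * y) * (φ : G → ℂ) y ∂Measure.haar := by
  have : Fact ((1 : ENNReal) ≠ ⊤) := ⟨ENNReal.one_ne_top⟩
  simp_rw [integral_translate]
  have hmk : Continuous (DomMulAct.mk : G → Gᵈᵐᵃ) := DomMulAct.continuous_mk
  exact (continuous_pairing φ).comp (hmk.smul continuous_const)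

lemma bounded_integral_translate (f : Lp ℂ 1 (Measure.haar : Measure G)) (φ : BoundedLM G) :
    ∃ C : ℝ, ∀ t : G, ‖∫ y, f (t * y) * (φ : G → ℂ) y ∂Measure.haar‖ ≤ C := by
  obtain ⟨C, hC⟩ := φ.2.2
  refine ⟨‖f‖ * C, fun t => ?_⟩
  rw [integral_translate]
  simpa using norm_pairing_le (DomMulAct.mk t • f) φ hC

lemma conv_eq (f : Lp ℂ 1 (Measure.haar : Measure G)) (φ : BoundedLM G) (x : G) :
    ∫ y, f y * (φ : G → ℂ) (y⁻¹ * x) ∂Measure.haar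
      = ∫ y, f (x * y) * (reflect φ : G → ℂ) y ∂Measure.haar := by
  rw [← integral_mul_left_eq_self (fun y => f y * (φ : G → ℂ) (y⁻¹ * x)) x]
  simp [reflect]

/-- The convolution `(f * φ)(x) = ∫ f(y) φ(y⁻¹x) dy`. -/
def conv (f : Lp ℂ 1 (Measure.haar : Measure G)) (φ : BoundedLM G) : BoundedLM G :=
  ⟨fun x => ∫ y, f y * (φ : G → ℂ) (y⁻¹ * x) ∂Measure.haar, by
    simp_rw [conv_eq]
    exact mem_boundedLM_of_continuous (continuous_integral_translate f _)
      (bounded_integral_translate f _)⟩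

/-- `(φ f)(t) = ⟨l_t f, φ⟩ = ∫ f(t⁻¹y) φ(y) dy`. -/
def rightAct (φ : BoundedLM G) (f : Lp ℂ 1 (Measure.haar : Measure G)) : BoundedLM G :=
  ⟨fun t => ∫ y, f (t⁻¹ * y) * (φ : G → ℂ) y ∂Measure.haar,
    mem_boundedLM_of_continuous ((continuous_integral_translate f φ).comp continuous_inv)
      ((bounded_integral_translate f φ).imp fun _ hC t => hC t⁻¹)⟩

variable (G) in
/-- The topological left-invariant means on `L_∞(G)`. -/
def TLIM : Set (Linfty G →ₗ[ℂ] ℂ) :=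
  {m | IsMean m ∧ ∀ φ : BoundedLM G, ∀ f ∈ P1 G, m (toLinfty (φ - conv f φ)) = 0}

variable (G) in
/-- The topological right-invariant means on `L_∞(G)`. -/
def TRIM : Set (Linfty G →ₗ[ℂ] ℂ) :=
  {m | IsMean m ∧ ∀ φ : BoundedLM G, ∀ f ∈ P1 G, m (toLinfty (φ - rightAct φ f)) = 0}

variable (G) in
/-- The topological two-sided invariant means on `L_∞(G)`. -/
def TIM : Set (Linfty G →ₗ[ℂ] ℂ) := TLIM G ∩ TRIM G

end

end TopInvMean

/-! Since κ > 1 it is infinite: a finite cover by compact sets would make G compact.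

Upper bound. Fix f in `P1 G`. A topological left-invariant mean satisfies m(φ) = m(f * φ), so it is
determined by its values on the functions f * φ. The value of such a function at x pairs the
translate of f by x⁻¹ with a fixed bounded function, and the orbit of f in L_1 has a dense subset of
size at most κ, because each of κ compact sets has separable image. Hence there are at most 2^κ
functions f * φ (`mk_range_conv_le`) and at most 2^(2^κ) means (`mk_TLIM_le`).

Lower bound. Take κ indices i, compact sets K_i that eventually absorb every compact set, open U_i ⊆
K_i doing the same, and points x_i with the sets K_i x_i K_i pairwise disjoint
(`exists_pairwise_disjoint_translates`). Fix a compactly supported density h and a right-invariant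
mean m on bounded continuous functions. An ultrafilter p on the indices gives M_p(φ) = m_a m_b lim_p
(l_a h * (φ (l_b h)))(x_i). For a positive functional Λ on L_1 the average k ↦ m(a ↦ Λ(l_a k)) is
positive and left-invariant, hence a multiple of the Haar integral (`exists_eq_mul_integral`). So h
may be replaced by h ⋆ g whenever g has integral one (`IsRightMean.avg_lconv`), and this is exactly
two-sided topological invariance once g has been moved from φ to h. Moving it needs associativity
and the commutation `rightAct_conv`, which is delicate because Haar measure need not be σ-finite and
φ is only locally measurable.

Before the limit, M_p sees φ only at points s⁻¹a⁻¹x_i b t with s, t in a compact set carrying h, and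
these eventually lie in U_i x_i U_i. If A belongs to p but not to q, the indicator of the union of
the U_i x_i U_i over A therefore has M_p-value 1 and M_q-value 0. An independent-family argument
supplies 2^(2^κ) suitable ultrafilters (`two_power_le_mk_ultrafilter`). -/

namespace TopInvMean

noncomputable section

variable {G : Type*} [Group G] [TopologicalSpace G] [IsTopologicalGroup G] [T2Space G]
  [LocallyCompactSpace G] [MeasurableSpace G] [BorelSpace G]

/-! ### Translations, pairings and convolution on L_1(G) -/

variable (G) in
/-- The group algebra `L_1(G)`. -/
abbrev LOne := Lp ℂ 1 (Measure.haar : Measure G)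

/-- The left translate `(l_y k)(x) = k (y⁻¹ x)` on `L_1(G)`. -/
def leftTr (y : G) (k : LOne G) : LOne G := DomMulAct.mk y⁻¹ • k

lemma leftTr_ae_eq (y : G) (k : LOne G) :
    leftTr y k =ᵐ[Measure.haar] fun x => k (y⁻¹ * x) :=
  DomMulAct.smul_Lp_ae_eq _ k

lemma leftTr_mul (x y : G) (k : LOne G) : leftTr (x * y) k = leftTr x (leftTr y k) := by
  rw [leftTr, leftTr, leftTr, smul_smul, ← DomMulAct.mk_mul, mul_inv_rev]

lemma norm_leftTr (y : G) (k : LOne G) : ‖leftTr y k‖ = ‖k‖ := DomMulAct.norm_smul_Lp _ _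

/-- Left translation as a continuous linear map. -/
def leftTrL (y : G) : LOne G →L[ℂ] LOne G :=
  LinearMap.mkContinuous
    { toFun := leftTr y
      map_add' := fun f g => smul_add _ f g
      map_smul' := fun c f => smul_comm _ c f } 1 fun k => by
    rw [one_mul]
    exact (norm_leftTr y k).le

@[simp] lemma leftTrL_apply (y : G) (k : LOne G) : leftTrL y k = leftTr y k := rfl

lemma continuous_leftTr (k : LOne G) : Continuous fun y : G => leftTr y k := by
  have : Fact ((1 : ENNReal) ≠ ⊤) := ⟨ENNReal.one_ne_top⟩
  have hmk : Continuous (DomMulAct.mk : G → Gᵈᵐᵃ) := DomMulAct.continuous_mk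
  exact (hmk.comp continuous_inv).smul continuous_const

lemma integral_leftTr (y : G) (k : LOne G) :
    ∫ x, leftTr y k x ∂Measure.haar = ∫ x, k x ∂Measure.haar := by
  rw [integral_congr_ae (leftTr_ae_eq y k), integral_mul_left_eq_self (fun x => k x) y⁻¹]

lemma leftTr_nonneg (y : G) {k : LOne G} (hk : ∀ᵐ x ∂(Measure.haar : Measure G), 0 ≤ k x) :
    ∀ᵐ x ∂(Measure.haar : Measure G), 0 ≤ leftTr y k x := by
  filter_upwards [leftTr_ae_eq y k,
    (measurePreserving_mul_left Measure.haar y⁻¹).quasiMeasurePreserving.ae hk] with x h1 h2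
  rwa [h1]

/-- The pairing with a bounded locally measurable function as a continuous linear functional. -/
def pairingL (φ : BoundedLM G) : LOne G →L[ℂ] ℂ where
  toFun f := pairing f φ
  map_add' f g := by
    unfold pairing
    rw [← integral_add (integrable_mul f φ) (integrable_mul g φ)]
    refine integral_congr_ae ?_
    filter_upwards [Lp.coeFn_add f g] with x hx
    rw [hx, Pi.add_apply, add_mul]
  map_smul' c f := by
    unfold pairing
    rw [RingHom.id_apply, smul_eq_mul, ← integral_const_mul]
    refine integral_congr_ae ?_
    filter_upwards [Lp.coeFn_smul c f] with x hx
    rw [hx, Pi.smul_apply, smul_eq_mul, mul_assoc]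
  cont := continuous_pairing φ

@[simp] lemma pairingL_apply (φ : BoundedLM G) (f : LOne G) : pairingL φ f = pairing f φ := rfl

variable (G) in
/-- The integral as a continuous linear functional on `L_1(G)`. -/
def integralL : LOne G →L[ℂ] ℂ := pairingL (oneLM G)

lemma integralL_apply (k : LOne G) : integralL G k = ∫ x, k x ∂Measure.haar := by
  simp [integralL, pairing, oneLM]

lemma pairing_add (f : LOne G) (φ ψ : BoundedLM G) :
    pairing f (φ + ψ) = pairing f φ + pairing f ψ := by
  unfold pairing
  rw [← integral_add (integrable_mul f φ) (integrable_mul f ψ)]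
  simp [mul_add]

lemma pairing_smul (f : LOne G) (c : ℂ) (φ : BoundedLM G) :
    pairing f (c • φ) = c * pairing f φ := by
  unfold pairing
  rw [← integral_const_mul]
  refine integral_congr_ae (Eventually.of_forall fun x => ?_)
  simp only [Submodule.coe_smul, Pi.smul_apply, smul_eq_mul]
  ring

lemma rightAct_apply (φ : BoundedLM G) (f : LOne G) (t : G) :
    (rightAct φ f : G → ℂ) t = pairing (leftTr t f) φ :=
  integral_translate f φ t⁻¹

lemma conv_apply (f : LOne G) (φ : BoundedLM G) (x : G) :
    (conv f φ : G → ℂ) x = pairing (leftTr x⁻¹ f) (reflect φ) := by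
  rw [leftTr, inv_inv, ← integral_translate]
  exact conv_eq f φ x

/-- `f ↦ (φ f)(t)` as a continuous linear functional. -/
def rightActL (φ : BoundedLM G) (t : G) : LOne G →L[ℂ] ℂ := (pairingL φ).comp (leftTrL t)

lemma rightActL_apply (φ : BoundedLM G) (t : G) (f : LOne G) :
    rightActL φ t f = (rightAct φ f : G → ℂ) t := (rightAct_apply φ f t).symm

/-- `f ↦ (f * φ)(x)` as a continuous linear functional. -/
def convL (φ : BoundedLM G) (x : G) : LOne G →L[ℂ] ℂ := (pairingL (reflect φ)).comp (leftTrL x⁻¹)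

lemma convL_apply (φ : BoundedLM G) (x : G) (f : LOne G) :
    convL φ x f = (conv f φ : G → ℂ) x := (conv_apply f φ x).symm

lemma rightAct_leftTr (φ : BoundedLM G) (f : LOne G) (y t : G) :
    (rightAct φ (leftTr y f) : G → ℂ) t = (rightAct φ f : G → ℂ) (t * y) := by
  rw [rightAct_apply, rightAct_apply, leftTr_mul]

lemma conv_leftTr (φ : BoundedLM G) (f : LOne G) (y x : G) :
    (conv (leftTr y f) φ : G → ℂ) x = (conv f φ : G → ℂ) (y⁻¹ * x) := by
  rw [conv_apply, conv_apply, mul_inv_rev, inv_inv, leftTr_mul]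

lemma norm_conv_le (f : LOne G) (φ : BoundedLM G) {C : ℝ} (hC : ∀ x, ‖(φ : G → ℂ) x‖ ≤ C) (x : G) :
    ‖(conv f φ : G → ℂ) x‖ ≤ ‖f‖ * C := by
  rw [conv_apply, ← norm_leftTr x⁻¹ f]
  exact norm_pairing_le _ _ fun y => hC _

lemma norm_rightAct_le (f : LOne G) (φ : BoundedLM G) {C : ℝ} (hC : ∀ x, ‖(φ : G → ℂ) x‖ ≤ C)
    (t : G) : ‖(rightAct φ f : G → ℂ) t‖ ≤ ‖f‖ * C := by
  rw [rightAct_apply, ← norm_leftTr t f]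
  exact norm_pairing_le _ _ hC

/-! Convolution in `L_1(G)` -/

/-- The range of `u` may be non-separable, but `k` vanishes almost everywhere off a σ-compact set,
and on each compact piece the image of `u` is compact, hence separable. -/
lemma aestronglyMeasurable_smul_of_continuous {E : Type*} [NormedAddCommGroup E] [NormedSpace ℂ E]
    (k : LOne G) {u : G → E} (hu : Continuous u) :
    AEStronglyMeasurable (fun y => k y • u y) (Measure.haar : Measure G) := by
  obtain ⟨S, ⟨K, hK, rfl⟩, hS⟩ := exists_sigmaCompact k
  have hm : MeasurableSet (⋃ n, K n) := .iUnion fun n => (hK n).measurableSet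
  have h1 : AEStronglyMeasurable u (Measure.haar.restrict (⋃ n, K n)) :=
    aestronglyMeasurable_iUnion_iff.2 fun n =>
      hu.continuousOn.aestronglyMeasurable_of_isCompact (hK n) (hK n).measurableSet
  have h2 := (integrable_coe k).1.smul ((aestronglyMeasurable_indicator_iff hm).2 h1)
  refine h2.congr ?_
  filter_upwards [hS] with x hx
  by_cases hxS : x ∈ ⋃ n, K n
  · simp [Set.indicator_of_mem hxS]
  · simp [hx hxS]

lemma integrable_smul_leftTr (k g : LOne G) :
    Integrable (fun y => k y • leftTr y g) (Measure.haar : Measure G) := by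
  refine ((integrable_coe k).norm.mul_const ‖g‖).mono'
    (aestronglyMeasurable_smul_of_continuous k (continuous_leftTr g)) ?_
  refine Eventually.of_forall fun y => ?_
  rw [norm_smul, norm_leftTr]

/-- The convolution `k ⋆ g = ∫ k(y) l_y g dy` in `L_1(G)`. -/
def lconv (k g : LOne G) : LOne G := ∫ y, k y • leftTr y g ∂Measure.haar

lemma map_lconv (F : LOne G →L[ℂ] ℂ) (k g : LOne G) :
    F (lconv k g) = ∫ y, k y * F (leftTr y g) ∂Measure.haar := by
  rw [lconv, ← F.integral_comp_comm (integrable_smul_leftTr k g)]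
  simp

lemma integral_lconv (k g : LOne G) : integralL G (lconv k g) = integralL G k * integralL G g := by
  rw [map_lconv]
  simp_rw [integralL_apply, integral_leftTr]
  rw [integral_mul_const]

lemma leftTr_lconv (x : G) (k g : LOne G) : leftTr x (lconv k g) = lconv (leftTr x k) g := by
  have h := (leftTrL x).integral_comp_comm (integrable_smul_leftTr k g)
  rw [← leftTrL_apply, lconv, ← h, lconv,
    ← integral_mul_left_eq_self (fun y => leftTr x k y • leftTr y g) x]
  refine integral_congr_ae ?_
  filter_upwards [(measurePreserving_mul_left Measure.haar x).quasiMeasurePreserving.ae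
    (leftTr_ae_eq x k)] with y hy
  rw [hy, map_smul, leftTrL_apply, leftTr_mul]
  simp

/-- Evaluating f * θ at a point is a continuous functional of f, so it passes inside the Bochner
integral defining `lconv`. This takes the place of Fubini, also in `rightAct_rightAct`. -/
lemma conv_conv (k g : LOne G) (θ : BoundedLM G) : conv k (conv g θ) = conv (lconv k g) θ := by
  ext x
  rw [← convL_apply θ, map_lconv]
  simp_rw [convL_apply, conv_leftTr]
  rfl

lemma rightAct_rightAct (k g : LOne G) (φ : BoundedLM G) :
    rightAct (rightAct φ g) k = rightAct φ (lconv k g) := by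
  ext t
  rw [← rightActL_apply φ, map_lconv]
  simp_rw [rightActL_apply, rightAct_leftTr]
  change ∫ y, k (t⁻¹ * y) * (rightAct φ g : G → ℂ) y ∂Measure.haar = _
  rw [← integral_mul_left_eq_self _ t]
  simp

end

end TopInvMean

namespace TopInvMean

open scoped Pointwise

noncomputable section

/-! ### Density of compactly supported continuous functions in L_1 -/

section Density

variable {X : Type*} [TopologicalSpace X] [T2Space X] [LocallyCompactSpace X] [MeasurableSpace X]
  [BorelSpace X]

/-- Indicators of finite measure sets are approximated in `L_1` by compactly supported continuous
functions. -/
lemma exists_continuous_eLpNorm_indicator_le (μ : Measure X) [μ.Regular] (c : ℂ) {t : Set X}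
    (ht : MeasurableSet t) (htμ : μ t < ⊤) {ε : ENNReal} (hε : ε ≠ 0) :
    ∃ g : X → ℂ, eLpNorm (g - t.indicator fun _ => c) 1 μ ≤ ε ∧
      Continuous g ∧ MemLp g 1 μ ∧ HasCompactSupport g := by
  obtain ⟨η, ηpos, hη⟩ := exists_eLpNorm_indicator_le (μ := μ) ENNReal.one_ne_top c hε
  have hη0 : ((η / 2 : NNReal) : ENNReal) ≠ 0 := by simpa using ηpos.ne'
  -- Squeeze s ⊆ t ⊆ V with s compact and V open, losing η/2 on each side. A Urysohn function for s
  -- and V, times c, then differs from the indicator only on V \ s, and by at most ‖c‖.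
  obtain ⟨s, st, hs, hsμ⟩ := ht.exists_isCompact_sdiff_lt htμ.ne hη0
  obtain ⟨V, tV, hV, -, hVμ⟩ := ht.exists_isOpen_sdiff_lt htμ.ne hη0
  obtain ⟨f, hf1, hf0, hfc, hf⟩ := exists_continuous_one_zero_of_isCompact hs hV.isClosed_compl
    (Set.disjoint_compl_right_iff_subset.2 (st.trans tV))
  have hgc : Continuous fun x => (f x : ℂ) * c := by fun_prop
  have hcs : HasCompactSupport fun x => (f x : ℂ) * c :=
    (hfc.comp_left (g := fun r : ℝ => (r : ℂ)) Complex.ofReal_zero).mul_right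
  refine ⟨_, ?_, hgc, hgc.memLp_of_hasCompactSupport hcs, hcs⟩
  have hVs : μ (V \ s) ≤ η := by
    have h : V \ s ⊆ (V \ t) ∪ (t \ s) := fun x hx => by
      by_cases hxt : x ∈ t
      · exact Or.inr ⟨hxt, hx.2⟩
      · exact Or.inl ⟨hx.1, hxt⟩
    refine (measure_mono h).trans ((measure_union_le _ _).trans ((add_le_add hVμ.le hsμ.le).trans ?_))
    rw [← ENNReal.coe_add, add_halves]
  refine (eLpNorm_mono fun x => ?_).trans (hη _ hVs)
  by_cases hxs : x ∈ s
  · simp [hf1 hxs, st hxs, hxs]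
  by_cases hxV : x ∈ V
  · rw [Set.indicator_of_mem (show x ∈ V \ s from ⟨hxV, hxs⟩)]
    have h0 := (hf x).1
    have h1 := (hf x).2
    by_cases hxt : x ∈ t
    · have h2 : (f x : ℂ) * c - c = ((f x - 1 : ℝ) : ℂ) * c := by push_cast; ring
      simp only [Pi.sub_apply, Set.indicator_of_mem hxt, h2, norm_mul, Complex.norm_real,
        Real.norm_eq_abs]
      refine mul_le_of_le_one_left (norm_nonneg _) (abs_le.2 ⟨by linarith, by linarith⟩)
    · simp only [Pi.sub_apply, Set.indicator_of_notMem hxt, sub_zero, norm_mul, Complex.norm_real,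
        Real.norm_eq_abs]
      refine mul_le_of_le_one_left (norm_nonneg _) (abs_le.2 ⟨by linarith, by linarith⟩)
  · have hxt : x ∉ t := fun h => hxV (tV h)
    have h0 : f x = 0 := hf0 hxV
    simp [h0, hxt, hxV]

/-- Density of `C_c` in `L_1` for a regular measure on a locally compact Hausdorff space. -/
lemma exists_hasCompactSupport_integral_norm_sub_le {μ : Measure X} [μ.Regular] {f : X → ℂ}
    (hf : Integrable f μ) {ε : ℝ} (hε : 0 < ε) :
    ∃ g : X → ℂ, HasCompactSupport g ∧ ∫ x, ‖f x - g x‖ ∂μ ≤ ε ∧ Continuous g ∧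
      Integrable g μ := by
  obtain ⟨g, hg, hgc, hgm, hgs⟩ := (memLp_one_iff_integrable.2 hf).induction_dense
    ENNReal.one_ne_top (fun g : X → ℂ => Continuous g ∧ MemLp g 1 μ ∧ HasCompactSupport g)
    (fun c t ht htμ ε hε => exists_continuous_eLpNorm_indicator_le μ c ht htμ hε)
    (fun f g hf hg => ⟨hf.1.add hg.1, hf.2.1.add hg.2.1, hf.2.2.add hg.2.2⟩)
    (fun f hf => hf.2.1.aestronglyMeasurable) (ε := ENNReal.ofReal ε) (by simpa using hε)
  have hgi := memLp_one_iff_integrable.1 hgm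
  refine ⟨g, hgs, ?_, hgc, hgi⟩
  change ∫ x, ‖(f - g) x‖ ∂μ ≤ ε
  rw [integral_norm_eq_lintegral_enorm (hf.sub hgi).aestronglyMeasurable]
  rw [eLpNorm_one_eq_lintegral_enorm] at hg
  exact ENNReal.toReal_le_of_le_ofReal hε.le hg

end Density

variable {G : Type*} [Group G] [TopologicalSpace G] [IsTopologicalGroup G] [T2Space G]
  [LocallyCompactSpace G] [MeasurableSpace G] [BorelSpace G]

/-! ### The left and right actions of L_1(G) on bounded functions commute -/

lemma conv_add_right (g : LOne G) (φ ψ : BoundedLM G) :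
    conv g (φ + ψ) = conv g φ + conv g ψ := by
  ext x
  simp only [conv_apply, Submodule.coe_add, Pi.add_apply]
  exact pairing_add _ (reflect φ) (reflect ψ)

lemma conv_smul_right (g : LOne G) (c : ℂ) (φ : BoundedLM G) :
    conv g (c • φ) = c • conv g φ := by
  ext x
  simp only [conv_apply, Submodule.coe_smul, Pi.smul_apply]
  exact pairing_smul _ c (reflect φ)

lemma rightAct_add_left (g : LOne G) (φ ψ : BoundedLM G) :
    rightAct (φ + ψ) g = rightAct φ g + rightAct ψ g := by
  ext x
  simp only [rightAct_apply, Submodule.coe_add, Pi.add_apply]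
  exact pairing_add _ φ ψ

lemma rightAct_smul_left (g : LOne G) (c : ℂ) (φ : BoundedLM G) :
    rightAct (c • φ) g = c • rightAct φ g := by
  ext x
  simp only [rightAct_apply, Submodule.coe_smul, Pi.smul_apply]
  exact pairing_smul _ c φ

lemma conv_add_left (g h : LOne G) (φ : BoundedLM G) :
    conv (g + h) φ = conv g φ + conv h φ := by
  ext x
  simp only [← convL_apply, Submodule.coe_add, Pi.add_apply, map_add]

lemma conv_smul_left (c : ℂ) (g : LOne G) (φ : BoundedLM G) :
    conv (c • g) φ = c • conv g φ := by
  ext x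
  simp only [← convL_apply, Submodule.coe_smul, Pi.smul_apply, map_smul]

lemma rightAct_add_right (g h : LOne G) (φ : BoundedLM G) :
    rightAct φ (g + h) = rightAct φ g + rightAct φ h := by
  ext x
  simp only [← rightActL_apply, Submodule.coe_add, Pi.add_apply, map_add]

lemma rightAct_smul_right (c : ℂ) (g : LOne G) (φ : BoundedLM G) :
    rightAct φ (c • g) = c • rightAct φ g := by
  ext x
  simp only [← rightActL_apply, Submodule.coe_smul, Pi.smul_apply, map_smul]

/-- The bounded bilinear functional `(f, k) ↦ (f * (φ k))(x)`. -/
def convRightActL (φ : BoundedLM G) (x : G) : LOne G →L[ℂ] LOne G →L[ℂ] ℂ :=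
  LinearMap.mkContinuousOfExistsBound₂
    (LinearMap.mk₂ ℂ (fun f k => (conv f (rightAct φ k) : G → ℂ) x)
      (fun f g k => by simp [conv_add_left]) (fun c f k => by simp [conv_smul_left])
      (fun f k l => by simp [rightAct_add_right, conv_add_right])
      (fun c f k => by simp [rightAct_smul_right, conv_smul_right]))
    (φ.2.2.imp fun C hC f k => by
      rw [LinearMap.mk₂_apply]
      refine (norm_conv_le f _ (norm_rightAct_le k φ hC) x).trans (le_of_eq ?_)
      ring)

lemma convRightActL_apply (φ : BoundedLM G) (x : G) (f k : LOne G) :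
    convRightActL φ x f k = (conv f (rightAct φ k) : G → ℂ) x := rfl

/-- The bounded bilinear functional `(f, k) ↦ ((f * φ) k)(x)`. -/
def rightActConvL (φ : BoundedLM G) (x : G) : LOne G →L[ℂ] LOne G →L[ℂ] ℂ :=
  LinearMap.mkContinuousOfExistsBound₂
    (LinearMap.mk₂ ℂ (fun f k => (rightAct (conv f φ) k : G → ℂ) x)
      (fun f g k => by simp [conv_add_left, rightAct_add_left])
      (fun c f k => by simp [conv_smul_left, rightAct_smul_left])
      (fun f k l => by simp [rightAct_add_right])
      (fun c f k => by simp [rightAct_smul_right]))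
    (φ.2.2.imp fun C hC f k => by
      rw [LinearMap.mk₂_apply]
      refine (norm_rightAct_le k _ (norm_conv_le f φ hC) x).trans (le_of_eq ?_)
      ring)

lemma rightActConvL_apply (φ : BoundedLM G) (x : G) (f k : LOne G) :
    rightActConvL φ x f k = (rightAct (conv f φ) k : G → ℂ) x := rfl

lemma memLp_of_hasCompactSupport {u : G → ℂ} (hu : Continuous u) (hc : HasCompactSupport u) :
    MemLp u 1 (Measure.haar : Measure G) := hu.memLp_of_hasCompactSupport hc

/-- Continuous functions on `L_1(G)` that agree on `C_c(G)` are equal. -/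
lemma eq_of_eq_on_compactSupport {F₁ F₂ : LOne G → ℂ} (h₁ : Continuous F₁) (h₂ : Continuous F₂)
    (h : ∀ (u : G → ℂ) (hu : Continuous u) (hc : HasCompactSupport u),
      F₁ ((memLp_of_hasCompactSupport hu hc).toLp u) =
        F₂ ((memLp_of_hasCompactSupport hu hc).toLp u)) (k : LOne G) : F₁ k = F₂ k := by
  have hcl : IsClosed {k | F₁ k = F₂ k} := isClosed_eq h₁ h₂
  refine hcl.closure_subset (Metric.mem_closure_iff.2 fun ε hε => ?_)
  obtain ⟨u, hc, hk, hu, -⟩ := exists_hasCompactSupport_integral_norm_sub_le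
    (integrable_coe k) (half_pos hε)
  refine ⟨_, h u hu hc, ?_⟩
  rw [dist_eq_norm, L1.norm_eq_integral_norm]
  refine lt_of_le_of_lt (le_of_eq ?_) (lt_of_le_of_lt hk (half_lt_self hε))
  refine integral_congr_ae ?_
  filter_upwards [Lp.coeFn_sub k ((memLp_of_hasCompactSupport hu hc).toLp u),
    (memLp_of_hasCompactSupport hu hc).coeFn_toLp] with x h1 h2
  rw [h1, Pi.sub_apply, h2]

lemma conv_toLp {u : G → ℂ} (hu : MemLp u 1 (Measure.haar : Measure G)) (φ : BoundedLM G) (x : G) :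
    (conv (hu.toLp u) φ : G → ℂ) x = ∫ y, u y * (φ : G → ℂ) (y⁻¹ * x) ∂Measure.haar := by
  refine integral_congr_ae ?_
  filter_upwards [hu.coeFn_toLp] with y hy
  rw [hy]

lemma rightAct_toLp {u : G → ℂ} (hu : MemLp u 1 (Measure.haar : Measure G)) (φ : BoundedLM G)
    (t : G) :
    (rightAct φ (hu.toLp u) : G → ℂ) t = ∫ y, u (t⁻¹ * y) * (φ : G → ℂ) y ∂Measure.haar := by
  refine integral_congr_ae ?_
  filter_upwards [(measurePreserving_mul_left Measure.haar t⁻¹).quasiMeasurePreserving.ae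
    hu.coeFn_toLp] with y hy
  rw [hy]

/-- A bounded function on a compact set is approximated by continuous functions with compact
support, simultaneously with respect to left and right Haar measure. -/
lemma exists_continuous_approx {C : Set G} (hC : IsCompact C) {w : G → ℂ}
    (hw : Measurable w) (hb : ∃ M : ℝ, ∀ x, ‖w x‖ ≤ M) {ε : ℝ} (hε : 0 < ε) :
    ∃ f : G → ℂ, Continuous f ∧ HasCompactSupport f ∧
      ∫ x, C.indicator (fun x => ‖w x - f x‖) x ∂Measure.haar ≤ ε ∧
      ∫ x, C.indicator (fun x => ‖w x - f x‖) x⁻¹ ∂Measure.haar ≤ ε := by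
  have hm := hC.measurableSet
  have i1 : IsFiniteMeasure ((Measure.haar : Measure G).restrict C) :=
    ⟨by simpa using hC.measure_lt_top⟩
  have i2 : IsFiniteMeasure ((Measure.haar : Measure G).inv.restrict C) :=
    ⟨by simpa using hC.inv.measure_lt_top⟩
  -- Approximating in L_1 of the sum of the two measures makes one f serve for both estimates.
  set ν : Measure G := Measure.haar.restrict C + Measure.haar.inv.restrict C with hν
  have hreg : ν.Regular := inferInstance
  obtain ⟨M, hM⟩ := hb
  have hwi : Integrable w ν := Integrable.of_bound hw.aestronglyMeasurable M
    (Eventually.of_forall hM)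
  obtain ⟨f, hfc, hle, hf, hfi⟩ := exists_hasCompactSupport_integral_norm_sub_le hwi hε
  have hi : Integrable (fun x => ‖w x - f x‖) ν := (hwi.sub hfi).norm
  have hi' := hi
  rw [hν] at hi'
  rw [hν, integral_add_measure hi'.left_of_add_measure hi'.right_of_add_measure] at hle
  have p1 : 0 ≤ ∫ x in C, ‖w x - f x‖ ∂Measure.haar := integral_nonneg fun _ => norm_nonneg _
  have p2 : 0 ≤ ∫ x in C, ‖w x - f x‖ ∂Measure.haar.inv := integral_nonneg fun _ => norm_nonneg _
  refine ⟨f, hf, hfc, ?_, ?_⟩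
  · rw [integral_indicator hm]
    linarith
  · have h := (MeasurableEquiv.inv G).measurableEmbedding.integral_map (μ := Measure.haar)
      (C.indicator (fun x => ‖w x - f x‖))
    have h' : ∫ x, C.indicator (fun x => ‖w x - f x‖) x⁻¹ ∂Measure.haar =
        ∫ x, C.indicator (fun x => ‖w x - f x‖) x ∂Measure.haar.inv := h.symm
    rw [h', integral_indicator hm]
    linarith

/-- Fubini for a continuous integrand of compact support requires no σ-finiteness; the rest is left
invariance in y. -/
lemma integral_swap_of_continuous {u v : G → ℂ} (hu : Continuous u) (huc : HasCompactSupport u)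
    (hv : Continuous v) (hvc : HasCompactSupport v) {f : G → ℂ} (hf : Continuous f) (t : G) :
    ∫ y, v (t⁻¹ * y) * ∫ s, u s * f (s⁻¹ * y) ∂Measure.haar ∂Measure.haar =
      ∫ s, u s * ∫ y, v ((s⁻¹ * t)⁻¹ * y) * f y ∂Measure.haar ∂(Measure.haar : Measure G) := by
  have hsw : ∫ y, ∫ s, v (t⁻¹ * y) * (u s * f (s⁻¹ * y)) ∂(Measure.haar : Measure G)
        ∂(Measure.haar : Measure G) =
      ∫ s, ∫ y, v (t⁻¹ * y) * (u s * f (s⁻¹ * y)) ∂Measure.haar ∂(Measure.haar : Measure G) := by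
    refine integral_integral_swap_of_hasCompactSupport (by fun_prop) ?_
    refine HasCompactSupport.intro ((hvc.image (continuous_const_mul t)).prod huc) ?_
    rintro ⟨y, s⟩ hys
    by_contra h0
    refine hys ⟨⟨t⁻¹ * y, subset_tsupport _ fun h => h0 ?_, by simp⟩, subset_tsupport _ fun h => h0 ?_⟩
    · simp [h]
    · simp at h
      simp [h]
  simp_rw [integral_const_mul] at hsw
  rw [hsw]
  refine integral_congr_ae (Eventually.of_forall fun s => ?_)
  change _ = u s * _
  rw [← integral_const_mul, ← integral_mul_left_eq_self _ s⁻¹]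
  refine integral_congr_ae (Eventually.of_forall fun y => ?_)
  simp [mul_assoc]
  ring_nf

/-- The restriction of a bounded locally measurable function to a compact set. -/
def restrictLM {C : Set G} (hC : IsCompact C) (φ : BoundedLM G) : BoundedLM G :=
  ⟨C.indicator φ, fun _ hK => (φ.2.1 C hC).indicator hK.measurableSet,
    φ.2.2.imp fun _ hM x => (norm_indicator_le_norm_self _ _).trans (hM x)⟩

/-- Translating the variable by y turns the integrand into u(ys) δ(s⁻¹). The inversion here is the
reason the approximation must also be good for the reflected Haar measure. -/
lemma norm_conv_toLp_le {u : G → ℂ} {C : Set G} (hC : IsCompact C) {B : ℝ} (hB : ∀ x, ‖u x‖ ≤ B)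
    (hm : MemLp u 1 (Measure.haar : Measure G)) (δ : BoundedLM G) (hδ : Measurable (δ : G → ℂ))
    {y : G} (hy : ∀ s, u (y * s) ≠ 0 → s⁻¹ ∈ C) :
    ‖(conv (hm.toLp u) δ : G → ℂ) y‖ ≤
      B * ∫ x, C.indicator (fun x => ‖(δ : G → ℂ) x‖) x⁻¹ ∂Measure.haar := by
  obtain ⟨M, hM⟩ := δ.2.2
  rw [conv_toLp, ← integral_mul_left_eq_self _ y, ← integral_const_mul]
  refine norm_integral_le_of_norm_le (Integrable.const_mul ?_ B)
    (Eventually.of_forall fun s => ?_)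
  · have h1 : Integrable (C⁻¹.indicator fun _ => M) (Measure.haar : Measure G) :=
      (integrable_indicator_iff hC.inv.measurableSet).2
        (integrableOn_const hC.inv.measure_lt_top.ne)
    refine h1.mono' ?_ (Eventually.of_forall fun s => ?_)
    · exact ((hδ.norm.indicator hC.measurableSet).comp measurable_inv).aestronglyMeasurable
    · by_cases hs : s⁻¹ ∈ C
      · rw [Set.indicator_of_mem hs, Set.indicator_of_mem (Set.mem_inv.2 hs), norm_norm]
        exact hM _
      · rw [Set.indicator_of_notMem hs, Set.indicator_of_notMem (fun h => hs (Set.mem_inv.1 h)),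
          norm_zero]
  · have hB0 : 0 ≤ B := (norm_nonneg _).trans (hB 1)
    by_cases h0 : u (y * s) = 0
    · rw [h0, zero_mul, norm_zero]
      exact mul_nonneg hB0 (Set.indicator_nonneg (fun _ _ => norm_nonneg _) _)
    · rw [Set.indicator_of_mem (hy s h0), norm_mul]
      simpa using mul_le_mul_of_nonneg_right (hB (y * s)) (norm_nonneg _)

lemma norm_rightAct_toLp_le {v : G → ℂ} {C : Set G} (hC : IsCompact C) {B : ℝ} (hB : ∀ x, ‖v x‖ ≤ B)
    (hm : MemLp v 1 (Measure.haar : Measure G)) (δ : BoundedLM G) (hδ : Measurable (δ : G → ℂ))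
    {t : G} (ht : ∀ y, v (t⁻¹ * y) ≠ 0 → y ∈ C) :
    ‖(rightAct δ (hm.toLp v) : G → ℂ) t‖ ≤
      B * ∫ x, C.indicator (fun x => ‖(δ : G → ℂ) x‖) x ∂Measure.haar := by
  obtain ⟨M, hM⟩ := δ.2.2
  rw [rightAct_toLp, ← integral_const_mul]
  refine norm_integral_le_of_norm_le (Integrable.const_mul ?_ B)
    (Eventually.of_forall fun s => ?_)
  · have h1 : Integrable (C.indicator fun _ => M) (Measure.haar : Measure G) :=
      (integrable_indicator_iff hC.measurableSet).2 (integrableOn_const hC.measure_lt_top.ne)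
    refine h1.mono' ?_ (Eventually.of_forall fun s => ?_)
    · exact (hδ.norm.indicator hC.measurableSet).aestronglyMeasurable
    · by_cases hs : s ∈ C
      · rw [Set.indicator_of_mem hs, Set.indicator_of_mem hs, norm_norm]
        exact hM _
      · rw [Set.indicator_of_notMem hs, Set.indicator_of_notMem hs, norm_zero]
  · have hB0 : 0 ≤ B := (norm_nonneg _).trans (hB 1)
    by_cases h0 : v (t⁻¹ * s) = 0
    · rw [h0, zero_mul, norm_zero]
      exact mul_nonneg hB0 (Set.indicator_nonneg (fun _ _ => norm_nonneg _) _)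
    · rw [Set.indicator_of_mem (ht s h0), norm_mul]
      exact mul_le_mul_of_nonneg_right (hB _) (norm_nonneg _)

/-- At the point t both sides use φ only on the compact set C = (supp u)⁻¹ t (supp v), so φ may be
cut down to C and is then measurable. The difference D of the two sides vanishes on continuous f
with compact support by Fubini, and the two norm estimates bound D of the remainder by a constant
times ε. -/
lemma rightAct_conv_of_continuous {u v : G → ℂ} (hu : Continuous u) (huc : HasCompactSupport u)
    (hv : Continuous v) (hvc : HasCompactSupport v) (φ : BoundedLM G) (t : G) :
    (rightAct (conv ((memLp_of_hasCompactSupport hu huc).toLp u) φ)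
        ((memLp_of_hasCompactSupport hv hvc).toLp v) : G → ℂ) t =
      (conv ((memLp_of_hasCompactSupport hu huc).toLp u)
        (rightAct φ ((memLp_of_hasCompactSupport hv hvc).toLp v)) : G → ℂ) t := by
  have hum := memLp_of_hasCompactSupport hu huc
  have hvm := memLp_of_hasCompactSupport hv hvc
  set g := hum.toLp u with hg
  set k := hvm.toLp v with hk
  set D : BoundedLM G → ℂ :=
    fun φ => rightActConvL φ t g k - convRightActL φ t g k with hD
  suffices h : D φ = 0 from sub_eq_zero.1 h
  have hDsub : ∀ φ ψ, D φ = D ψ + D (φ - ψ) := by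
    intro φ ψ
    obtain ⟨δ, rfl⟩ : ∃ δ, φ = ψ + δ := ⟨φ - ψ, by simp⟩
    simp only [hD, rightActConvL_apply, convRightActL_apply, add_sub_cancel_left, conv_add_right,
      rightAct_add_left, Submodule.coe_add, Pi.add_apply]
    ring
  set C : Set G := (tsupport u)⁻¹ * ((fun y => t * y) '' tsupport v) with hCdef
  have hC : IsCompact C := huc.isCompact.inv.mul (hvc.isCompact.image (continuous_const_mul t))
  have hmem : ∀ s y, u s ≠ 0 → v (t⁻¹ * y) ≠ 0 → s⁻¹ * y ∈ C := fun s y hs hy =>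
    Set.mul_mem_mul (Set.inv_mem_inv.2 (subset_tsupport _ hs))
      ⟨t⁻¹ * y, subset_tsupport _ hy, by simp⟩
  have hrestr : D φ = D (restrictLM hC φ) := by
    simp only [hD, rightActConvL_apply, convRightActL_apply]
    congr 1
    · rw [hk, rightAct_toLp, rightAct_toLp]
      refine integral_congr_ae (Eventually.of_forall fun y => ?_)
      by_cases hy : v (t⁻¹ * y) = 0
      · simp [hy]
      dsimp only
      congr 1
      rw [hg, conv_toLp, conv_toLp]
      refine integral_congr_ae (Eventually.of_forall fun s => ?_)
      by_cases hs : u s = 0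
      · simp [hs]
      · simp [restrictLM, Set.indicator_of_mem (hmem s y hs hy)]
    · rw [hg, conv_toLp, conv_toLp]
      refine integral_congr_ae (Eventually.of_forall fun s => ?_)
      by_cases hs : u s = 0
      · simp [hs]
      dsimp only
      congr 1
      rw [hk, rightAct_toLp, rightAct_toLp]
      refine integral_congr_ae (Eventually.of_forall fun y => ?_)
      by_cases hy : v ((s⁻¹ * t)⁻¹ * y) = 0
      · dsimp only
        rw [hy, zero_mul, zero_mul]
      have h1 := hmem s (s * y) hs (by simpa [mul_assoc] using hy)
      rw [inv_mul_cancel_left] at h1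
      simp [restrictLM, Set.indicator_of_mem h1]
  obtain ⟨Bu, hBu⟩ := huc.exists_bound_of_continuous hu
  obtain ⟨Bv, hBv⟩ := hvc.exists_bound_of_continuous hv
  have hBu0 : 0 ≤ Bu := (norm_nonneg _).trans (hBu 1)
  have hBv0 : 0 ≤ Bv := (norm_nonneg _).trans (hBv 1)
  have hui : Integrable u (Measure.haar : Measure G) := memLp_one_iff_integrable.1 hum
  have hvi : Integrable v (Measure.haar : Measure G) := memLp_one_iff_integrable.1 hvm
  set Nu := ∫ x, ‖u x‖ ∂(Measure.haar : Measure G)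
  set Nv := ∫ x, ‖v x‖ ∂(Measure.haar : Measure G)
  have key : ∀ ε : ℝ, 0 < ε → ‖D φ‖ ≤ (Nv * Bu + Nu * Bv) * ε := by
    intro ε hε
    have hwm : Measurable (restrictLM hC φ : G → ℂ) := φ.2.1 C hC
    obtain ⟨f, hf, hfc, h1, h2⟩ := exists_continuous_approx hC hwm (restrictLM hC φ).2.2 hε
    set F : BoundedLM G := ⟨f, mem_boundedLM_of_continuous hf (hfc.exists_bound_of_continuous hf)⟩
      with hF
    have hDF : D F = 0 := by
      simp only [hD, rightActConvL_apply, convRightActL_apply]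
      rw [sub_eq_zero, hk, rightAct_toLp, hg, conv_toLp]
      simp_rw [conv_toLp, rightAct_toLp]
      exact integral_swap_of_continuous hu huc hv hvc hf t
    rw [hrestr, hDsub _ F, hDF, zero_add]
    set δ := restrictLM hC φ - F with hδ
    have hδm : Measurable (δ : G → ℂ) := hwm.sub hf.measurable
    have hi1 : ‖(rightAct (conv g δ) k : G → ℂ) t‖ ≤ Nv * (Bu * ε) := by
      rw [hk, rightAct_toLp]
      have hNv : Nv = ∫ y, ‖v (t⁻¹ * y)‖ ∂(Measure.haar : Measure G) :=
        (integral_mul_left_eq_self (fun y => ‖v y‖) t⁻¹).symm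
      rw [hNv, ← integral_mul_const]
      refine norm_integral_le_of_norm_le ((hvi.comp_mul_left t⁻¹).norm.mul_const _)
        (Eventually.of_forall fun y => ?_)
      rw [norm_mul]
      by_cases hy : v (t⁻¹ * y) = 0
      · simp [hy]
      refine mul_le_mul_of_nonneg_left ?_ (norm_nonneg _)
      refine (norm_conv_toLp_le hC hBu hum δ hδm fun s hs => ?_).trans
        (mul_le_mul_of_nonneg_left h2 hBu0)
      simpa using hmem (y * s) y hs hy
    have hi2 : ‖(conv g (rightAct δ k) : G → ℂ) t‖ ≤ Nu * (Bv * ε) := by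
      rw [hg, conv_toLp, ← integral_mul_const]
      refine norm_integral_le_of_norm_le (hui.norm.mul_const _)
        (Eventually.of_forall fun s => ?_)
      rw [norm_mul]
      by_cases hs : u s = 0
      · simp [hs]
      refine mul_le_mul_of_nonneg_left ?_ (norm_nonneg _)
      refine (norm_rightAct_toLp_le hC hBv hvm δ hδm fun y hy => ?_).trans
        (mul_le_mul_of_nonneg_left h1 hBv0)
      have h3 := hmem s (s * y) hs (by simpa [mul_assoc] using hy)
      rwa [inv_mul_cancel_left] at h3
    refine (norm_sub_le _ _).trans ((add_le_add hi1 hi2).trans (le_of_eq ?_))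
    ring
  have hlim : Tendsto (fun ε : ℝ => (Nv * Bu + Nu * Bv) * ε) (𝓝[>] 0) (𝓝 0) := by
    have := (continuous_const_mul (Nv * Bu + Nu * Bv)).tendsto (0 : ℝ)
    rw [mul_zero] at this
    exact this.mono_left nhdsWithin_le_nhds
  exact norm_le_zero_iff.1 (ge_of_tendsto hlim (eventually_mem_nhdsWithin.mono key))

/-- Left and right convolution actions on `L_∞(G)` commute. -/
theorem rightAct_conv (φ : BoundedLM G) (g k : LOne G) :
    rightAct (conv g φ) k = conv g (rightAct φ k) := by
  ext t
  change rightActConvL φ t g k = convRightActL φ t g k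
  -- Both sides are bounded bilinear in (g, k), so each variable in turn can be taken in C_c(G).
  refine eq_of_eq_on_compactSupport (F₁ := fun k => rightActConvL φ t g k)
    (F₂ := fun k => convRightActL φ t g k) (ContinuousLinearMap.continuous _)
    (ContinuousLinearMap.continuous _) (fun v hv hvc => ?_) k
  refine eq_of_eq_on_compactSupport
    (F₁ := fun g => rightActConvL φ t g ((memLp_of_hasCompactSupport hv hvc).toLp v))
    (F₂ := fun g => convRightActL φ t g ((memLp_of_hasCompactSupport hv hvc).toLp v))
    (by fun_prop) (by fun_prop) (fun u hu huc => ?_) g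
  exact rightAct_conv_of_continuous hu huc hv hvc φ t

end

end TopInvMean

namespace TopInvMean

open scoped CompactlySupported

noncomputable section

variable {G : Type*} [Group G] [TopologicalSpace G] [IsTopologicalGroup G] [T2Space G]
  [LocallyCompactSpace G] [MeasurableSpace G] [BorelSpace G]

/-! ### Uniqueness of the positive left-invariant functional on L_1(G) -/

lemma memLp_ofReal (u : C_c(G, ℝ)) :
    MemLp (fun x => (u x : ℂ)) 1 (Measure.haar : Measure G) :=
  memLp_of_hasCompactSupport (Complex.continuous_ofReal.comp u.continuous)
    (u.hasCompactSupport.comp_left (g := fun r : ℝ => (r : ℂ)) Complex.ofReal_zero)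

/-- The class in `L_1(G)` of a real function in `C_c(G)`. -/
def ccToLOne : C_c(G, ℝ) →ₗ[ℝ] LOne G where
  toFun u := (memLp_ofReal u).toLp _
  map_add' u v := by
    rw [← MemLp.toLp_add]
    congr 1
    ext x
    simp
  map_smul' c u := by
    rw [RingHom.id_apply, ← MemLp.toLp_const_smul]
    congr 1
    ext x
    simp

lemma ccToLOne_nonneg {u : C_c(G, ℝ)} (hu : ∀ x, 0 ≤ u x) :
    ∀ᵐ x ∂(Measure.haar : Measure G), 0 ≤ ccToLOne u x := by
  filter_upwards [(memLp_ofReal u).coeFn_toLp] with x hx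
  change 0 ≤ (memLp_ofReal u).toLp _ x
  rw [hx]
  exact_mod_cast hu x

lemma integralL_ccToLOne (u : C_c(G, ℝ)) :
    integralL G (ccToLOne u) = ((∫ x, u x ∂Measure.haar : ℝ) : ℂ) := by
  rw [integralL_apply, ← integral_complex_ofReal]
  exact integral_congr_ae (memLp_ofReal u).coeFn_toLp

/-- Left translation on `C_c(G)`. -/
def ccTranslate (y : G) (u : C_c(G, ℝ)) : C_c(G, ℝ) where
  toFun x := u (y⁻¹ * x)
  continuous_toFun := u.continuous.comp (continuous_const_mul y⁻¹)
  hasCompactSupport' := u.hasCompactSupport.comp_homeomorph (Homeomorph.mulLeft y⁻¹)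

lemma ccToLOne_translate (y : G) (u : C_c(G, ℝ)) :
    ccToLOne (ccTranslate y u) = leftTr y (ccToLOne u) := rfl

/-- The absolute value on `C_c(G)`. -/
def ccAbs (u : C_c(G, ℝ)) : C_c(G, ℝ) where
  toFun x := |u x|
  continuous_toFun := u.continuous.abs
  hasCompactSupport' := u.hasCompactSupport.comp_left abs_zero

variable {F : LOne G →L[ℂ] ℂ}

/-- Riesz–Markov represents Re F on C_c(G) by a regular measure. Invariance of F makes this measure
left-invariant, so uniqueness of Haar measure gives the constant. -/
lemma exists_integral_ccToLOne
    (hpos : ∀ k : LOne G, (∀ᵐ x ∂(Measure.haar : Measure G), 0 ≤ k x) → 0 ≤ F k)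
    (hinv : ∀ (y : G) (k : LOne G), F (leftTr y k) = F k) :
    ∃ c : ℝ, ∀ u : C_c(G, ℝ), F (ccToLOne u) = c * integralL G (ccToLOne u) := by
  set Λ₀ : C_c(G, ℝ) →ₗ[ℝ] ℝ :=
    (Complex.reLm ∘ₗ F.toLinearMap.restrictScalars ℝ) ∘ₗ ccToLOne with hΛ₀
  have hΛpos : ∀ u, 0 ≤ u → 0 ≤ Λ₀ u := fun u hu =>
    (Complex.nonneg_iff.1 (hpos _ (ccToLOne_nonneg hu))).1
  set Λ : C_c(G, ℝ) →ₚ[ℝ] ℝ := PositiveLinearMap.mk₀ Λ₀ hΛpos with hΛ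
  set μ := RealRMK.rieszMeasure Λ with hμ
  have hint : ∀ u : C_c(G, ℝ), ∫ x, u x ∂μ = (F (ccToLOne u)).re :=
    fun u => RealRMK.integral_rieszMeasure Λ u
  have hinvμ : μ.IsMulLeftInvariant := by
    refine ⟨fun y => ?_⟩
    have hreg : (Measure.map (y * ·) μ).Regular := Measure.Regular.map (Homeomorph.mulLeft y)
    refine Measure.ext_of_integral_eq_on_compactlySupported fun u => ?_
    refine ((Homeomorph.mulLeft y).measurableEmbedding.integral_map _).trans ?_
    have h := hint (ccTranslate y⁻¹ u)
    rw [ccToLOne_translate, hinv, ← hint] at h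
    simpa [ccTranslate] using h
  obtain ⟨c, hc⟩ := Measure.exists_integral_isMulLeftInvariant_eq_smul_of_hasCompactSupport μ
    Measure.haar
  refine ⟨c, fun u => ?_⟩
  have him : ∀ u : C_c(G, ℝ), (∀ x, 0 ≤ u x) → (F (ccToLOne u)).im = 0 := fun u hu =>
    (Complex.nonneg_iff.1 (hpos _ (ccToLOne_nonneg hu))).2.symm
  -- A difference of nonnegative functions, on each of which F is real.
  have hu : u = (u + ccAbs u) - ccAbs u := by simp
  have him' : (F (ccToLOne u)).im = 0 := by
    rw [hu, map_sub, map_sub, Complex.sub_im, him (ccAbs u) fun x => abs_nonneg (u x),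
      him (u + ccAbs u) fun x => ?_, sub_zero]
    have := neg_abs_le (u x)
    change 0 ≤ u x + |u x|
    linarith
  rw [integralL_ccToLOne, ← Complex.ofReal_mul]
  refine Complex.ext ?_ (by rw [him', Complex.ofReal_im])
  rw [← hint, hc u u.continuous u.hasCompactSupport, Complex.ofReal_re,
    integral_smul_nnreal_measure]
  rfl

/-- A positive left-invariant continuous functional on `L_1(G)` is a multiple of the integral. -/
theorem exists_eq_mul_integral
    (hpos : ∀ k : LOne G, (∀ᵐ x ∂(Measure.haar : Measure G), 0 ≤ k x) → 0 ≤ F k)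
    (hinv : ∀ (y : G) (k : LOne G), F (leftTr y k) = F k) :
    ∃ c : ℝ, ∀ k, F k = c * integralL G k := by
  obtain ⟨c, hc⟩ := exists_integral_ccToLOne hpos hinv
  refine ⟨c, fun k => ?_⟩
  refine eq_of_eq_on_compactSupport (F₁ := F) (F₂ := fun k => c * integralL G k) F.continuous
    (by fun_prop) (fun u hu huc => ?_) k
  set a : C_c(G, ℝ) := ⟨⟨fun x => (u x).re, Complex.continuous_re.comp hu⟩,
    huc.comp_left Complex.zero_re⟩ with ha
  set b : C_c(G, ℝ) := ⟨⟨fun x => (u x).im, Complex.continuous_im.comp hu⟩,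
    huc.comp_left Complex.zero_im⟩ with hb
  have hab : (memLp_of_hasCompactSupport hu huc).toLp u =
      ccToLOne a + Complex.I • ccToLOne b := by
    change _ = (memLp_ofReal a).toLp _ + Complex.I • (memLp_ofReal b).toLp _
    rw [← MemLp.toLp_const_smul, ← MemLp.toLp_add]
    congr 1
    ext x
    simp only [Pi.add_apply, Pi.smul_apply, smul_eq_mul]
    rw [mul_comm]
    exact (Complex.re_add_im (u x)).symm
  simp only [hab, map_add, map_smul, hc, smul_eq_mul]
  ring

end

end TopInvMean

namespace TopInvMean

open scoped Pointwise

universe u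

/-! ### Counting ultrafilters by an independent family -/

section Ultrafilters

variable {J : Type u}

open scoped Classical in
/-- The trace of a set `X` on `i.1` belongs to `i.2` exactly when `X` belongs to `E`. -/
def traceSet (E : Set (Set J)) (X : Set J) : Set (Finset J × Finset (Finset J)) :=
  {i | i.1.filter (· ∈ X) ∈ i.2 ↔ X ∈ E}

/-- The indices whose first component contains `A`. -/
def tailSet (A : Finset J) : Set (Finset J × Finset (Finset J)) := {i | A ⊆ i.1}

/-- Enlarge A to a finite D on which distinct members of S have distinct traces, and let the second
component consist of the traces of those members that lie in E. -/
lemma exists_mem_tailSet_traceSet (E : Set (Set J)) (A : Finset J) (S : Finset (Set J)) :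
    ∃ i, i ∈ tailSet A ∧ ∀ X ∈ S, i ∈ traceSet E X := by
  classical
  have hsep : ∀ X Y : Set J, ∃ B : Finset J, X ≠ Y → ∃ j ∈ B, ¬(j ∈ X ↔ j ∈ Y) := by
    intro X Y
    by_cases h : ∃ j, ¬(j ∈ X ↔ j ∈ Y)
    · obtain ⟨j, hj⟩ := h
      exact ⟨{j}, fun _ => ⟨j, by simp, hj⟩⟩
    · push Not at h
      exact ⟨∅, fun hne => (hne (Set.ext h)).elim⟩
  choose B hB using hsep
  set D : Finset J := A ∪ S.biUnion fun X => S.biUnion fun Y => B X Y with hD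
  refine ⟨(D, (S.filter (· ∈ E)).image fun X => D.filter (· ∈ X)),
    Finset.subset_union_left, fun X hX => ?_⟩
  simp only [traceSet, Set.mem_ofPred_eq, Finset.mem_image, Finset.mem_filter]
  refine ⟨?_, fun h => ⟨X, ⟨hX, h⟩, rfl⟩⟩
  rintro ⟨Y, ⟨hY, hYE⟩, hYX⟩
  by_contra hXE
  obtain ⟨j, hj, hne⟩ := hB X Y fun h => hXE (h ▸ hYE)
  have hjD : j ∈ D := Finset.mem_union_right _
    (Finset.mem_biUnion.2 ⟨X, hX, Finset.mem_biUnion.2 ⟨Y, hY, hj⟩⟩)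
  have := Finset.ext_iff.1 hYX j
  simp only [Finset.mem_filter, hjD, true_and] at this
  exact hne this.symm

/-- The previous lemma is the finite intersection property of the tails together with the sets
`traceSet E X`. -/
lemma exists_ultrafilter_traceSet (E : Set (Set J)) :
    ∃ p : Ultrafilter (Finset J × Finset (Finset J)),
      (∀ A, tailSet A ∈ p) ∧ ∀ X, traceSet E X ∈ p := by
  classical
  set b : Finset J × Finset (Set J) → Set (Finset J × Finset (Finset J)) :=
    fun a => {i | i ∈ tailSet a.1 ∧ ∀ X ∈ a.2, i ∈ traceSet E X} with hb
  have hne : (⨅ a, 𝓟 (b a)).NeBot := by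
    refine iInf_neBot_of_directed' (fun a c => ⟨(a.1 ∪ c.1, a.2 ∪ c.2), ?_, ?_⟩) fun a => ?_
    · refine principal_mono.2 fun i hi => ⟨Finset.subset_union_left.trans hi.1, fun X hX => ?_⟩
      exact hi.2 X (Finset.mem_union_left _ hX)
    · refine principal_mono.2 fun i hi => ⟨Finset.subset_union_right.trans hi.1, fun X hX => ?_⟩
      exact hi.2 X (Finset.mem_union_right _ hX)
    · exact principal_neBot_iff.2 (exists_mem_tailSet_traceSet E a.1 a.2)
  have hmem : ∀ a, b a ∈ Ultrafilter.of (⨅ a, 𝓟 (b a)) := fun a =>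
    Ultrafilter.of_le _ (mem_iInf_of_mem a (mem_principal_self _))
  refine ⟨_, fun A => mem_of_superset (hmem (A, ∅)) fun i hi => hi.1, fun X =>
    mem_of_superset (hmem (∅, {X})) fun i hi => hi.2 X (Finset.mem_singleton_self X)⟩

/-- There are as many ultrafilters containing all the tails as possible. -/
lemma two_power_le_mk_ultrafilter (J : Type u) :
    (2 : Cardinal.{u}) ^ (2 : Cardinal.{u}) ^ #J ≤
      #{p : Ultrafilter (Finset J × Finset (Finset J)) // ∀ A, tailSet A ∈ p} := by
  choose p hp1 hp2 using exists_ultrafilter_traceSet (J := J)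
  rw [← Cardinal.mk_set, ← Cardinal.mk_set]
  refine Cardinal.mk_le_of_injective (f := fun E => ⟨p E, hp1 E⟩) fun E E' h => ?_
  have hpp : p E = p E' := congrArg Subtype.val h
  ext X
  have h1 := hp2 E X
  rw [hpp] at h1
  -- The same index decides membership of X in E and in E', so E can be read off from its
  -- ultrafilter.
  obtain ⟨i, hi, hi'⟩ := (p E').nonempty_of_mem (inter_mem h1 (hp2 E' X))
  exact hi.symm.trans hi'

end Ultrafilters

/-! ### Compact covers and disjoint translates -/

section Covering

variable {G : Type u} [TopologicalSpace G]

lemma exists_notMem_iUnion_of_lt {S : Type u} (C : S → Set G) (hC : ∀ s, IsCompact (C s))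
    (hS : #S < compactCoveringNumber G) : ∃ g, ∀ s, g ∉ C s := by
  by_contra! h
  refine hS.not_ge (le_trans (csInf_le' (a := #(Set.range C)) ⟨Set.range C, ?_, ?_, rfl⟩)
    Cardinal.mk_range_le)
  · rintro _ ⟨s, rfl⟩
    exact hC s
  · exact Set.eq_univ_of_forall fun g => by simpa using h g

lemma exists_cover (G : Type u) [TopologicalSpace G] :
    ∃ 𝒦 : Set (Set G), (∀ K ∈ 𝒦, IsCompact K) ∧ ⋃₀ 𝒦 = Set.univ ∧
      #𝒦 = compactCoveringNumber G :=
  csInf_mem (s := {c : Cardinal | ∃ 𝒦 : Set (Set G), (∀ K ∈ 𝒦, IsCompact K) ∧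
    ⋃₀ 𝒦 = Set.univ ∧ #𝒦 = c})
    ⟨_, Set.range fun g : G => {g}, by rintro _ ⟨g, rfl⟩; exact isCompact_singleton,
      Set.eq_univ_of_forall fun g => ⟨{g}, ⟨g, rfl⟩, rfl⟩, rfl⟩

lemma aleph0_le_compactCoveringNumber (h : 1 < compactCoveringNumber G) :
    ℵ₀ ≤ compactCoveringNumber G := by
  obtain ⟨𝒦, hK, hcov, hcard⟩ := exists_cover G
  by_contra! hlt
  rw [← hcard, Cardinal.lt_aleph0_iff_set_finite] at hlt
  have huniv : IsCompact (Set.univ : Set G) := by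
    rw [← hcov, Set.sUnion_eq_biUnion]
    exact hlt.isCompact_biUnion hK
  refine h.not_ge (csInf_le' (a := 1) ⟨{Set.univ}, ?_, by simp, by simp⟩)
  rintro K rfl
  exact huniv

variable [Group G] [IsTopologicalGroup G]

/-- A group has a cover by `κ(G)` open sets, each contained in a compact set. -/
lemma exists_open_cover [LocallyCompactSpace G] :
    ∃ (J : Type u) (K U : J → Set G), #J = compactCoveringNumber G ∧ (∀ j, IsCompact (K j)) ∧
      (∀ j, IsOpen (U j)) ∧ (∀ j, U j ⊆ K j) ∧ ⋃ j, U j = Set.univ := by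
  obtain ⟨𝒦, hK, hcov, hcard⟩ := exists_cover G
  obtain ⟨V, hV, hV1⟩ := exists_compact_mem_nhds (1 : G)
  -- Thickening by a compact neighbourhood of 1 makes the cover open without adding members, so that
  -- compact sets have finite subcovers.
  refine ⟨𝒦, fun K => K * V, fun K => K * interior V, hcard, fun K => (hK K K.2).mul hV,
    fun K => isOpen_interior.mul_left, fun K => Set.mul_subset_mul_left interior_subset,
    Set.eq_univ_of_forall fun g => ?_⟩
  obtain ⟨K, hKK, hg⟩ := hcov.symm ▸ Set.mem_univ g
  exact Set.mem_iUnion.2 ⟨⟨K, hKK⟩, Set.mem_mul.2 ⟨g, hg, 1, mem_interior_iff_mem_nhds.2 hV1,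
    mul_one g⟩⟩

/-- A family of `κ(G)` compact sets has pairwise disjoint two-sided translates. -/
lemma exists_pairwise_disjoint_translates {I : Type u} (hI : #I = compactCoveringNumber G)
    (K : I → Set G) (hK : ∀ i, IsCompact (K i)) :
    ∃ x : I → G, Pairwise (Function.onFun Disjoint fun i => K i * {x i} * K i) := by
  classical
  -- In a well-order of minimal type each index has fewer than κ predecessors, so the points can be
  -- chosen by transfinite recursion.
  obtain ⟨r, wo, hr⟩ := Cardinal.exists_ord_eq I
  have hex : ∀ i (y : ∀ j, r j i → G),
      ∃ g, ∀ j (hj : r j i), Disjoint (K i * {g} * K i) (K j * {y j hj} * K j) := by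
    intro i y
    -- If K_i g K_i met K_j y_j K_j, then g would lie in the compact set K_i⁻¹ K_j y_j K_j K_i⁻¹.
    -- Fewer than κ of these cannot cover G.
    obtain ⟨g, hg⟩ := exists_notMem_iUnion_of_lt
      (S := {j // r j i}) (fun j => (K i)⁻¹ * (K j * {y j j.2} * K j) * (K i)⁻¹)
      (fun j => ((hK i).inv.mul (((hK j).mul isCompact_singleton).mul (hK j))).mul (hK i).inv)
      (by
        rw [← hI]
        exact Cardinal.card_typein_lt i hr)
    refine ⟨g, fun j hj => Set.disjoint_left.2 ?_⟩
    rintro _ ⟨_, ⟨a, ha, g', hg', rfl⟩, b, hb, rfl⟩ hmem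
    rw [Set.mem_singleton_iff.1 hg'] at hmem
    refine hg ⟨j, hj⟩ ⟨a⁻¹ * (a * g * b), ⟨a⁻¹, Set.inv_mem_inv.2 ha, _, hmem, rfl⟩,
      b⁻¹, Set.inv_mem_inv.2 hb, ?_⟩
    group
  choose c hc using hex
  have wf : WellFounded r := wo.wf
  set x : I → G := wf.fix c with hx
  have hfix : ∀ i, x i = c i fun j _ => x j := fun i => wf.fix_eq c i
  have key : ∀ i j, r j i → Disjoint (K i * {x i} * K i) (K j * {x j} * K j) := by
    intro i j hj
    have := hc i (fun j _ => x j) j hj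
    rwa [← hfix] at this
  refine ⟨x, fun i j hij => ?_⟩
  rcases trichotomous_of r i j with h | h | h
  · exact (key j i h).symm
  · exact (hij h).elim
  · exact key i j h

end Covering

end TopInvMean

namespace TopInvMean

open scoped BoundedContinuousFunction

noncomputable section

variable {G : Type*} [Group G] [TopologicalSpace G] [IsTopologicalGroup G] [T2Space G]
  [LocallyCompactSpace G] [MeasurableSpace G] [BorelSpace G]

/-! ### Right-invariant means on bounded continuous functions -/

/-- A right-invariant mean on the bounded continuous functions. -/
structure IsRightMean (m : (G →ᵇ ℂ) →L[ℂ] ℂ) : Prop where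
  const : ∀ (ψ : G →ᵇ ℂ) (c : ℂ), (∀ x, ψ x = c) → m ψ = c
  nonneg : ∀ ψ : G →ᵇ ℂ, (∀ x, 0 ≤ ψ x) → 0 ≤ m ψ
  right_inv : ∀ (ψ ψ' : G →ᵇ ℂ) (z : G), (∀ x, ψ' x = ψ (x * z)) → m ψ' = m ψ

/-- A bounded continuous function as an element of `BoundedLM`. -/
def bcToLM : (G →ᵇ ℂ) →ₗ[ℂ] BoundedLM G where
  toFun ψ := ⟨ψ, mem_boundedLM_of_continuous ψ.continuous ⟨‖ψ‖, ψ.norm_coe_le_norm⟩⟩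
  map_add' _ _ := rfl
  map_smul' _ _ := rfl

/-- Reflection as a linear map. -/
def reflectₗ : BoundedLM G →ₗ[ℂ] BoundedLM G where
  toFun := reflect
  map_add' _ _ := rfl
  map_smul' _ _ := rfl

/-- The real part of a bounded continuous function. -/
def bcRe (ψ : G →ᵇ ℂ) : G →ᵇ ℂ :=
  BoundedContinuousFunction.ofNormedAddCommGroup (fun x => ((ψ x).re : ℂ))
    (Complex.continuous_ofReal.comp (Complex.continuous_re.comp ψ.continuous)) ‖ψ‖ fun x => by
      rw [Complex.norm_real]
      exact (Complex.abs_re_le_norm _).trans (ψ.norm_coe_le_norm x)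

lemma bcRe_apply (ψ : G →ᵇ ℂ) (x : G) : bcRe ψ x = ((ψ x).re : ℂ) := rfl

/-- Positivity applied to ‖ψ‖ ± Re ψ makes the value at Re ψ real and traps it between ±‖ψ‖. -/
lemma norm_map_bcRe_le (m : (G →ᵇ ℂ) →ₗ[ℂ] ℂ) (h1 : m (.const G 1) = 1)
    (hpos : ∀ ψ : G →ᵇ ℂ, (∀ x, 0 ≤ ψ x) → 0 ≤ m ψ) (ψ : G →ᵇ ℂ) : ‖m (bcRe ψ)‖ ≤ ‖ψ‖ := by
  set c : G →ᵇ ℂ := (‖ψ‖ : ℂ) • .const G 1 with hc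
  have hmc : m c = (‖ψ‖ : ℂ) := by rw [hc, map_smul, h1, smul_eq_mul, mul_one]
  have hb : ∀ x, |(ψ x).re| ≤ ‖ψ‖ := fun x =>
    (Complex.abs_re_le_norm _).trans (ψ.norm_coe_le_norm x)
  have hp := hpos (c - bcRe ψ) fun x => by
    have : (c - bcRe ψ) x = ((‖ψ‖ - (ψ x).re : ℝ) : ℂ) := by simp [hc, bcRe_apply]
    rw [this]
    exact_mod_cast sub_nonneg.2 (abs_le.1 (hb x)).2
  have hm := hpos (c + bcRe ψ) fun x => by
    have : (c + bcRe ψ) x = ((‖ψ‖ + (ψ x).re : ℝ) : ℂ) := by simp [hc, bcRe_apply]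
    rw [this]
    have := (abs_le.1 (hb x)).1
    exact_mod_cast (by linarith : 0 ≤ ‖ψ‖ + (ψ x).re)
  rw [map_sub, hmc] at hp
  rw [map_add, hmc] at hm
  rw [Complex.nonneg_iff] at hp hm
  simp only [Complex.sub_re, Complex.add_re, Complex.ofReal_re, Complex.sub_im, Complex.add_im,
    Complex.ofReal_im] at hp hm
  have him : (m (bcRe ψ)).im = 0 := by linarith [hp.2]
  have hre : m (bcRe ψ) = ((m (bcRe ψ)).re : ℂ) := Complex.ext rfl (by simpa using him)
  rw [hre, Complex.norm_real]
  exact abs_le.2 ⟨by linarith, by linarith⟩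

/-- Real and imaginary parts contribute ‖ψ‖ each; the crude factor 2 suffices, since only continuity
is needed. -/
lemma norm_map_le (m : (G →ᵇ ℂ) →ₗ[ℂ] ℂ) (h1 : m (.const G 1) = 1)
    (hpos : ∀ ψ : G →ᵇ ℂ, (∀ x, 0 ≤ ψ x) → 0 ≤ m ψ) (ψ : G →ᵇ ℂ) : ‖m ψ‖ ≤ 2 * ‖ψ‖ := by
  have hψ : ψ = bcRe ψ + Complex.I • bcRe (-Complex.I • ψ) := by
    ext x
    simp only [BoundedContinuousFunction.coe_add, BoundedContinuousFunction.coe_smul, Pi.add_apply,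
      bcRe_apply]
    apply Complex.ext <;> simp
  have h2 := norm_map_bcRe_le m h1 hpos ψ
  have h3 := norm_map_bcRe_le m h1 hpos (-Complex.I • ψ)
  have h4 : ‖-Complex.I • ψ‖ = ‖ψ‖ := by simp [norm_smul]
  rw [h4] at h3
  rw [hψ, map_add, map_smul]
  refine (norm_add_le _ _).trans ?_
  rw [norm_smul, Complex.norm_I, one_mul, ← hψ]
  linarith

/-- An amenable group has a right-invariant mean on bounded continuous functions. -/
lemma IsAmenable.exists_isRightMean (hG : IsAmenable G) :
    ∃ m : (G →ᵇ ℂ) →L[ℂ] ℂ, IsRightMean m := by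
  obtain ⟨m₀, ⟨h1, hpos⟩, hinv⟩ := hG
  -- Reflection turns left invariance into right invariance, which is what averaging over l_x l_y =
  -- l_{xy} needs.
  set m : (G →ᵇ ℂ) →ₗ[ℂ] ℂ := m₀ ∘ₗ toLinfty ∘ₗ reflectₗ ∘ₗ bcToLM with hm
  have hm1 : m (.const G 1) = 1 := h1
  have hmpos : ∀ ψ : G →ᵇ ℂ, (∀ x, 0 ≤ ψ x) → 0 ≤ m ψ := fun ψ hψ => by
    refine hpos _ fun K _ => ?_
    have : {x | ¬ 0 ≤ (reflectₗ (bcToLM ψ) : G → ℂ) x} = ∅ :=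
      Set.eq_empty_of_forall_notMem fun x hx => hx (hψ x⁻¹)
    simp [this]
  refine ⟨m.mkContinuous 2 (norm_map_le m hm1 hmpos), fun ψ c hψ => ?_, hmpos,
    fun ψ ψ' z hψ => ?_⟩
  · have : ψ = c • .const G 1 := by
      ext x
      simp [hψ]
    rw [LinearMap.mkContinuous_apply, this, map_smul, hm1, smul_eq_mul, mul_one]
  · have h := hinv (reflect (bcToLM ψ)) z
    rw [map_sub, map_sub, sub_eq_zero] at h
    refine Eq.trans ?_ h.symm
    change m₀ (toLinfty (reflect (bcToLM ψ'))) = _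
    congr 2
    ext x
    change ψ' x⁻¹ = ψ (z⁻¹ * x)⁻¹
    rw [hψ, mul_inv_rev, inv_inv]

/-! ### Averaging functionals over orbits -/

/-- The bounded continuous function `x ↦ Λ (l_x k)`. -/
def orbitFun (Λ : LOne G →L[ℂ] ℂ) (k : LOne G) : G →ᵇ ℂ :=
  BoundedContinuousFunction.ofNormedAddCommGroup (fun x => Λ (leftTr x k))
    (Λ.continuous.comp (continuous_leftTr k)) (‖Λ‖ * ‖k‖) fun x => by
      rw [← norm_leftTr x k]
      exact Λ.le_opNorm _

lemma orbitFun_apply (Λ : LOne G →L[ℂ] ℂ) (k : LOne G) (x : G) :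
    orbitFun Λ k x = Λ (leftTr x k) := rfl

/-- The mean of the orbit function `x ↦ Λ (l_x k)`, as a bounded bilinear functional. -/
def avg (m : (G →ᵇ ℂ) →L[ℂ] ℂ) : (LOne G →L[ℂ] ℂ) →L[ℂ] LOne G →L[ℂ] ℂ :=
  LinearMap.mkContinuous₂
    (LinearMap.mk₂ ℂ (fun Λ k => m (orbitFun Λ k))
      (fun Λ Λ' k => by rw [← map_add]; rfl)
      (fun c Λ k => by rw [← map_smul]; rfl)
      (fun Λ k l => by
        rw [← map_add]
        congr 1
        ext x
        simp [orbitFun_apply, ← leftTrL_apply])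
      (fun c Λ k => by
        rw [← map_smul]
        congr 1
        ext x
        simp [orbitFun_apply, ← leftTrL_apply]))
    ‖m‖ fun Λ k => by
      rw [LinearMap.mk₂_apply, mul_assoc]
      exact m.le_opNorm_of_le (BoundedContinuousFunction.norm_ofNormedAddCommGroup_le _
        (by positivity) _)

lemma avg_apply (m : (G →ᵇ ℂ) →L[ℂ] ℂ) (Λ : LOne G →L[ℂ] ℂ) (k : LOne G) :
    avg m Λ k = m (orbitFun Λ k) := rfl

variable {m : (G →ᵇ ℂ) →L[ℂ] ℂ}

lemma avg_congr {Λ Λ' : LOne G →L[ℂ] ℂ} {k k' : LOne G}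
    (h : ∀ x, Λ (leftTr x k) = Λ' (leftTr x k')) : avg m Λ k = avg m Λ' k' := by
  rw [avg_apply, avg_apply]
  congr 1
  ext x
  exact h x

/-- A functional on `L_1(G)` is positive if it is nonnegative on nonnegative functions. -/
def IsPositive (Λ : LOne G →L[ℂ] ℂ) : Prop :=
  ∀ k : LOne G, (∀ᵐ x ∂(Measure.haar : Measure G), 0 ≤ k x) → 0 ≤ Λ k

lemma IsRightMean.avg_const (hm : IsRightMean m) {Λ : LOne G →L[ℂ] ℂ} {k : LOne G} {c : ℂ}
    (h : ∀ x, Λ (leftTr x k) = c) : avg m Λ k = c := hm.const _ c h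

lemma IsRightMean.isPositive_avg (hm : IsRightMean m) {Λ : LOne G →L[ℂ] ℂ} (hΛ : IsPositive Λ) :
    IsPositive (avg m Λ) :=
  fun _ hk => hm.nonneg _ fun x => hΛ _ (leftTr_nonneg x hk)

lemma IsRightMean.avg_leftTr (hm : IsRightMean m) (Λ : LOne G →L[ℂ] ℂ) (y : G) (k : LOne G) :
    avg m Λ (leftTr y k) = avg m Λ k :=
  hm.right_inv _ _ y fun x => by rw [orbitFun_apply, orbitFun_apply, leftTr_mul]

/-- The average of a positive functional depends only on the integral. -/
lemma IsRightMean.avg_eq (hm : IsRightMean m) {Λ : LOne G →L[ℂ] ℂ} (hΛ : IsPositive Λ)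
    {k l : LOne G} (h : integralL G k = integralL G l) : avg m Λ k = avg m Λ l := by
  obtain ⟨c, hc⟩ := exists_eq_mul_integral (hm.isPositive_avg hΛ) (hm.avg_leftTr Λ)
  rw [hc, hc, h]

/-- The source of both topological invariances: convolving with g of integral one does not change
the integral. -/
lemma IsRightMean.avg_lconv (hm : IsRightMean m) {Λ : LOne G →L[ℂ] ℂ} (hΛ : IsPositive Λ)
    (h : LOne G) {g : LOne G} (hg : integralL G g = 1) : avg m Λ (lconv h g) = avg m Λ h :=
  hm.avg_eq hΛ (by rw [integral_lconv, hg, mul_one])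

/-! ### Limits along ultrafilters -/

section UltrafilterLimit

variable {I : Type*} (p : Ultrafilter I) {u v : I → ℂ} {C D : ℝ}

lemma tendsto_limUnder_of_bounded (hu : ∀ i, ‖u i‖ ≤ C) :
    Tendsto u p (𝓝 (limUnder (p : Filter I) u)) := by
  have hmem : Metric.closedBall (0 : ℂ) C ∈ (p.map u : Filter ℂ) := by
    rw [Ultrafilter.mem_coe, Ultrafilter.mem_map]
    exact univ_mem' fun i => by simpa using hu i
  obtain ⟨z, -, hz⟩ := (isCompact_closedBall (0 : ℂ) C).ultrafilter_le_nhds' (p.map u) hmem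
  exact tendsto_nhds_limUnder ⟨z, hz⟩

lemma limUnder_add_of_bounded (hu : ∀ i, ‖u i‖ ≤ C) (hv : ∀ i, ‖v i‖ ≤ D) :
    limUnder (p : Filter I) (fun i => u i + v i) =
      limUnder (p : Filter I) u + limUnder (p : Filter I) v :=
  ((tendsto_limUnder_of_bounded p hu).add (tendsto_limUnder_of_bounded p hv)).limUnder_eq

lemma limUnder_smul_of_bounded (c : ℂ) (hu : ∀ i, ‖u i‖ ≤ C) :
    limUnder (p : Filter I) (fun i => c * u i) = c * limUnder (p : Filter I) u :=
  ((tendsto_limUnder_of_bounded p hu).const_mul c).limUnder_eq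

lemma norm_limUnder_le_of_bounded (hu : ∀ i, ‖u i‖ ≤ C) : ‖limUnder (p : Filter I) u‖ ≤ C :=
  le_of_tendsto (tendsto_limUnder_of_bounded p hu).norm (Eventually.of_forall hu)

end UltrafilterLimit

end

end TopInvMean

namespace TopInvMean

open scoped BoundedContinuousFunction Pointwise

noncomputable section

variable {G : Type*} [Group G] [TopologicalSpace G] [IsTopologicalGroup G] [T2Space G]
  [LocallyCompactSpace G] [MeasurableSpace G] [BorelSpace G]

/-! ### Positivity and null functions -/

lemma pairing_eq_zero_of_mem {φ : BoundedLM G} (hφ : φ ∈ locallyNullFunctions G) (f : LOne G) :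
    pairing f φ = 0 := by
  obtain ⟨S, ⟨K, hK, rfl⟩, hS⟩ := exists_sigmaCompact f
  have h0 : ∀ᵐ x ∂(Measure.haar : Measure G), ∀ n, x ∉ {x | (φ : G → ℂ) x ≠ 0} ∩ K n :=
    ae_all_iff.2 fun n => measure_eq_zero_iff_ae_notMem.1 (hφ (K n) (hK n))
  refine integral_eq_zero_of_ae ?_
  filter_upwards [hS, h0] with x h1 h2
  by_cases hx : x ∈ ⋃ n, K n
  · obtain ⟨n, hn⟩ := Set.mem_iUnion.1 hx
    have : (φ : G → ℂ) x = 0 := by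
      by_contra h
      exact h2 n ⟨h, hn⟩
    simp [this]
  · simp [h1 hx]

lemma pairing_nonneg {φ : BoundedLM G} (hφ : IsLocallyNull {x | ¬ 0 ≤ (φ : G → ℂ) x}) {f : LOne G}
    (hf : ∀ᵐ x ∂(Measure.haar : Measure G), 0 ≤ f x) : 0 ≤ pairing f φ := by
  obtain ⟨S, ⟨K, hK, rfl⟩, hS⟩ := exists_sigmaCompact f
  have h0 : ∀ᵐ x ∂(Measure.haar : Measure G), ∀ n, x ∉ {x | ¬ 0 ≤ (φ : G → ℂ) x} ∩ K n :=
    ae_all_iff.2 fun n => measure_eq_zero_iff_ae_notMem.1 (hφ (K n) (hK n))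
  refine integral_nonneg_of_ae ?_
  filter_upwards [hS, h0, hf] with x h1 h2 h3
  by_cases hx : x ∈ ⋃ n, K n
  · obtain ⟨n, hn⟩ := Set.mem_iUnion.1 hx
    have : 0 ≤ (φ : G → ℂ) x := by
      by_contra h
      exact h2 n ⟨h, hn⟩
    exact mul_nonneg h3 this
  · simp [h1 hx]

lemma isLocallyNull_of_nonneg {φ : BoundedLM G} (hφ : ∀ x, 0 ≤ (φ : G → ℂ) x) :
    IsLocallyNull {x | ¬ 0 ≤ (φ : G → ℂ) x} := fun K _ => by
  simp [hφ]

lemma rightAct_nonneg {φ : BoundedLM G} (hφ : IsLocallyNull {x | ¬ 0 ≤ (φ : G → ℂ) x})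
    {f : LOne G} (hf : ∀ᵐ x ∂(Measure.haar : Measure G), 0 ≤ f x) (t : G) :
    0 ≤ (rightAct φ f : G → ℂ) t := by
  rw [rightAct_apply]
  exact pairing_nonneg hφ (leftTr_nonneg t hf)

lemma conv_nonneg {φ : BoundedLM G} (hφ : ∀ x, 0 ≤ (φ : G → ℂ) x)
    {f : LOne G} (hf : ∀ᵐ x ∂(Measure.haar : Measure G), 0 ≤ f x) (x : G) :
    0 ≤ (conv f φ : G → ℂ) x := by
  rw [conv_apply]
  exact pairing_nonneg (isLocallyNull_of_nonneg fun y => hφ y⁻¹) (leftTr_nonneg _ hf)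

lemma rightAct_eq_zero {φ : BoundedLM G} (hφ : φ ∈ locallyNullFunctions G) (f : LOne G) :
    rightAct φ f = 0 := by
  ext t
  rw [rightAct_apply, pairing_eq_zero_of_mem hφ]
  rfl

lemma conv_eq_const {h : LOne G} {φ : BoundedLM G} {x : G} {c : ℂ}
    (H : ∀ᵐ y ∂(Measure.haar : Measure G), h y ≠ 0 → (φ : G → ℂ) (y⁻¹ * x) = c) :
    (conv h φ : G → ℂ) x = integralL G h * c := by
  rw [integralL_apply, ← integral_mul_const]
  refine integral_congr_ae ?_
  filter_upwards [H] with y hy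
  by_cases h0 : h y = 0
  · simp [h0]
  · rw [hy h0]

lemma rightAct_eq_const {h : LOne G} {φ : BoundedLM G} {t : G} {c : ℂ}
    (H : ∀ᵐ y ∂(Measure.haar : Measure G), h y ≠ 0 → (φ : G → ℂ) (t * y) = c) :
    (rightAct φ h : G → ℂ) t = integralL G h * c := by
  rw [integralL_apply, ← integral_mul_const]
  change ∫ y, h (t⁻¹ * y) * (φ : G → ℂ) y ∂Measure.haar = _
  rw [← integral_mul_left_eq_self _ t]
  refine integral_congr_ae ?_
  filter_upwards [H] with y hy
  by_cases h0 : h y = 0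
  · simp [h0]
  · simp [hy h0]

/-- A subspace of `BoundedLM G` containing all nonnegative functions is everything. -/
lemma mem_of_forall_nonneg_mem (S : Submodule ℂ (BoundedLM G))
    (hS : ∀ φ : BoundedLM G, (∀ x, 0 ≤ (φ : G → ℂ) x) → φ ∈ S) (φ : BoundedLM G) : φ ∈ S := by
  have hreal : ∀ r : G → ℝ, (hr : (fun x => (r x : ℂ)) ∈ BoundedLM G) → ⟨_, hr⟩ ∈ S := by
    intro r hr
    obtain ⟨C, hC⟩ := hr.2
    -- A real function bounded by C becomes nonnegative after adding the constant C.
    have h1 : (C : ℂ) • oneLM G ∈ S := hS _ fun x => by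
      have : 0 ≤ C := (norm_nonneg _).trans (hC 1)
      simpa [oneLM] using this
    have h2 : ⟨_, hr⟩ + (C : ℂ) • oneLM G ∈ S := hS _ fun x => by
      have h3 := hC x
      rw [Complex.norm_real] at h3
      have h4 := (abs_le.1 h3).1
      have h5 : 0 ≤ r x + C := by linarith
      have h6 : ((⟨_, hr⟩ + (C : ℂ) • oneLM G : BoundedLM G) : G → ℂ) x = ((r x + C : ℝ) : ℂ) := by
        simp [oneLM]
      rw [h6]
      exact_mod_cast h5
    simpa using S.sub_mem h2 h1
  have hre : (fun x => (((φ : G → ℂ) x).re : ℂ)) ∈ BoundedLM G := by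
    refine ⟨fun K hK => ?_, φ.2.2.imp fun C hC x => ?_⟩
    · convert Complex.measurable_ofReal.comp (Complex.measurable_re.comp (φ.2.1 K hK)) using 1
      ext x
      by_cases hx : x ∈ K <;> simp [hx]
    · rw [Complex.norm_real]
      exact (Complex.abs_re_le_norm _).trans (hC x)
  have him : (fun x => (((φ : G → ℂ) x).im : ℂ)) ∈ BoundedLM G := by
    refine ⟨fun K hK => ?_, φ.2.2.imp fun C hC x => ?_⟩
    · convert Complex.measurable_ofReal.comp (Complex.measurable_im.comp (φ.2.1 K hK)) using 1
      ext x
      by_cases hx : x ∈ K <;> simp [hx]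
    · rw [Complex.norm_real]
      exact (Complex.abs_im_le_norm _).trans (hC x)
  have hφ : φ = ⟨_, hre⟩ + Complex.I • ⟨_, him⟩ := by
    ext x
    change (φ : G → ℂ) x = (((φ : G → ℂ) x).re : ℂ) + Complex.I * (((φ : G → ℂ) x).im : ℂ)
    rw [mul_comm]
    exact (Complex.re_add_im _).symm
  rw [hφ]
  exact S.add_mem (hreal _ hre) (S.smul_mem _ (hreal _ him))

/-! ### The means attached to ultrafilters -/

section Means

variable {I : Type*} (p : Ultrafilter I) (x : I → G)

lemma norm_conv_rightAct_le {φ : BoundedLM G} {C : ℝ} (hC : ∀ x, ‖(φ : G → ℂ) x‖ ≤ C)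
    (f k : LOne G) (z : G) : ‖(conv f (rightAct φ k) : G → ℂ) z‖ ≤ C * ‖f‖ * ‖k‖ := by
  refine (norm_conv_le f _ (norm_rightAct_le k φ hC) z).trans (le_of_eq ?_)
  ring

/-- The bounded bilinear functional `(f, k) ↦ lim_p (f * (φ k))(x_i)`. -/
def limForm (φ : BoundedLM G) : LOne G →L[ℂ] LOne G →L[ℂ] ℂ :=
  LinearMap.mkContinuousOfExistsBound₂
    (LinearMap.mk₂ ℂ
      (fun f k => limUnder (p : Filter I) fun i => (conv f (rightAct φ k) : G → ℂ) (x i))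
      (fun f g k => by
        obtain ⟨C, hC⟩ := φ.2.2
        rw [← limUnder_add_of_bounded p (fun i => norm_conv_rightAct_le hC f k (x i))
          (fun i => norm_conv_rightAct_le hC g k (x i))]
        simp [conv_add_left])
      (fun c f k => by
        obtain ⟨C, hC⟩ := φ.2.2
        rw [smul_eq_mul, ← limUnder_smul_of_bounded p c
          (fun i => norm_conv_rightAct_le hC f k (x i))]
        simp [conv_smul_left])
      (fun f k l => by
        obtain ⟨C, hC⟩ := φ.2.2
        rw [← limUnder_add_of_bounded p (fun i => norm_conv_rightAct_le hC f k (x i))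
          (fun i => norm_conv_rightAct_le hC f l (x i))]
        simp [rightAct_add_right, conv_add_right])
      (fun c f k => by
        obtain ⟨C, hC⟩ := φ.2.2
        rw [smul_eq_mul, ← limUnder_smul_of_bounded p c
          (fun i => norm_conv_rightAct_le hC f k (x i))]
        simp [rightAct_smul_right, conv_smul_right]))
    (φ.2.2.imp fun _ hC f k => norm_limUnder_le_of_bounded p
      fun i => norm_conv_rightAct_le hC f k (x i))

lemma limForm_apply (φ : BoundedLM G) (f k : LOne G) :
    limForm p x φ f k = limUnder (p : Filter I) fun i => (conv f (rightAct φ k) : G → ℂ) (x i) :=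
  rfl

lemma tendsto_limForm (φ : BoundedLM G) (f k : LOne G) :
    Tendsto (fun i => (conv f (rightAct φ k) : G → ℂ) (x i)) p (𝓝 (limForm p x φ f k)) := by
  obtain ⟨C, hC⟩ := φ.2.2
  exact tendsto_limUnder_of_bounded p fun i => norm_conv_rightAct_le hC f k (x i)

lemma limForm_add (φ ψ : BoundedLM G) :
    limForm p x (φ + ψ) = limForm p x φ + limForm p x ψ := by
  ext f k
  refine tendsto_nhds_unique (tendsto_limForm p x (φ + ψ) f k) ?_
  have := (tendsto_limForm p x φ f k).add (tendsto_limForm p x ψ f k)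
  simpa [rightAct_add_left, conv_add_right] using this

lemma limForm_smul (c : ℂ) (φ : BoundedLM G) : limForm p x (c • φ) = c • limForm p x φ := by
  ext f k
  refine tendsto_nhds_unique (tendsto_limForm p x (c • φ) f k) ?_
  have := (tendsto_limForm p x φ f k).const_mul c
  simpa [rightAct_smul_left, conv_smul_right] using this

lemma limForm_nonneg {φ : BoundedLM G} (hφ : IsLocallyNull {x | ¬ 0 ≤ (φ : G → ℂ) x})
    {f k : LOne G} (hf : ∀ᵐ x ∂(Measure.haar : Measure G), 0 ≤ f x)
    (hk : ∀ᵐ x ∂(Measure.haar : Measure G), 0 ≤ k x) : 0 ≤ limForm p x φ f k :=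
  ge_of_tendsto' (tendsto_limForm p x φ f k) fun i =>
    conv_nonneg (rightAct_nonneg hφ hk) hf (x i)

/-- The right action sends a locally null function to one that is identically zero, so evaluation at
the points x_i is well defined on classes. -/
lemma limForm_eq_zero {φ : BoundedLM G} (hφ : φ ∈ locallyNullFunctions G) :
    limForm p x φ = 0 := by
  ext f k
  refine tendsto_nhds_unique (tendsto_limForm p x φ f k) ?_
  have h : conv f (0 : BoundedLM G) = 0 := by simpa using conv_smul_right f 0 0
  simp [rightAct_eq_zero hφ, h]

/-- The commutation `rightAct_conv` carries g past the right action of k, after which f absorbs it.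
-/
lemma limForm_conv (φ : BoundedLM G) (g f k : LOne G) :
    limForm p x (conv g φ) f k = limForm p x φ (lconv f g) k := by
  simp_rw [limForm_apply, rightAct_conv, conv_conv]

lemma limForm_rightAct (φ : BoundedLM G) (g f k : LOne G) :
    limForm p x (rightAct φ g) f k = limForm p x φ f (lconv k g) := by
  simp_rw [limForm_apply, rightAct_rightAct]

variable (m : (G →ᵇ ℂ) →L[ℂ] ℂ) (h : LOne G)

/-- The average of `limForm` in its second variable. -/
def innerAvg (φ : BoundedLM G) : LOne G →L[ℂ] ℂ := ((avg m).flip h).comp (limForm p x φ)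

lemma innerAvg_apply (φ : BoundedLM G) (f : LOne G) :
    innerAvg p x m h φ f = avg m (limForm p x φ f) h := rfl

/-- The functional `φ ↦ m_s m_t lim_p (l_s h * (φ (l_t h)))(x_i)` on bounded functions. -/
def ultraMeanLM : BoundedLM G →ₗ[ℂ] ℂ where
  toFun φ := avg m (innerAvg p x m h φ) h
  map_add' φ ψ := by
    simp only [innerAvg, limForm_add, ContinuousLinearMap.comp_add, map_add,
      add_apply]
  map_smul' c φ := by
    simp only [innerAvg, limForm_smul, ContinuousLinearMap.comp_smul, map_smul,
      smul_apply, RingHom.id_apply]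

/-- The functional on `L_∞(G)` induced by `ultraMeanLM`. -/
def ultraMean : Linfty G →ₗ[ℂ] ℂ :=
  (locallyNullFunctions G).liftQ (ultraMeanLM p x m h) fun φ hφ => by
    simp [ultraMeanLM, innerAvg, limForm_eq_zero p x hφ]

lemma ultraMean_apply (φ : BoundedLM G) :
    ultraMean p x m h (toLinfty φ) = avg m (innerAvg p x m h φ) h := rfl

variable {p x m h}

/-- Unfolding the translates, the quantity under the limit is the average of φ(s⁻¹ a⁻¹ x_i b t) with
weights h(s) and h(t). If φ is eventually c at all these points, the limit is c for every a and b,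
and the means fix constants. -/
lemma ultraMean_eq_of_eventually (hm : IsRightMean m) (h1 : integralL G h = 1) {S : Set G}
    (hS : ∀ᵐ y ∂(Measure.haar : Measure G), y ∉ S → h y = 0) {φ : BoundedLM G} {c : ℂ}
    (H : ∀ a b : G, ∀ᶠ i in (p : Filter I), ∀ s ∈ S, ∀ t ∈ S,
      (φ : G → ℂ) (s⁻¹ * (a⁻¹ * x i) * b * t) = c) :
    ultraMean p x m h (toLinfty φ) = c := by
  rw [ultraMean_apply]
  refine hm.avg_const fun a => ?_
  rw [innerAvg_apply]
  refine hm.avg_const fun b => ?_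
  refine tendsto_nhds_unique (tendsto_limForm p x φ _ _) (tendsto_const_nhds.congr' ?_)
  filter_upwards [H a b] with i hi
  rw [conv_leftTr, conv_eq_const (c := c), h1, one_mul]
  filter_upwards [hS] with s hs hs0
  rw [rightAct_leftTr, rightAct_eq_const (c := c), h1, one_mul]
  filter_upwards [hS] with t ht ht0
  exact hi s (not_imp_comm.1 hs hs0) t (not_imp_comm.1 ht ht0)

lemma isPositive_innerAvg (hm : IsRightMean m)
    (h0 : ∀ᵐ x ∂(Measure.haar : Measure G), 0 ≤ h x) {φ : BoundedLM G}
    (hφ : IsLocallyNull {x | ¬ 0 ≤ (φ : G → ℂ) x}) : IsPositive (innerAvg p x m h φ) :=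
  fun _ hf => hm.isPositive_avg (fun _ hk => limForm_nonneg p x hφ hf hk) h h0

lemma isMean_ultraMean (hm : IsRightMean m) (h1 : integralL G h = 1)
    (h0 : ∀ᵐ x ∂(Measure.haar : Measure G), 0 ≤ h x) : IsMean (ultraMean p x m h) :=
  ⟨ultraMean_eq_of_eventually hm h1 (S := Set.univ) (by simp) (by simp [oneLM]),
    fun _ hφ => hm.isPositive_avg (isPositive_innerAvg hm h0 hφ) h h0⟩

/-- Passing from φ to g * φ replaces h by h ⋆ g in the outer average. `IsRightMean.avg_lconv`
removes g when φ ≥ 0, where the averaged functional is positive; linearity gives the rest. -/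
lemma ultraMean_conv (hm : IsRightMean m)
    (h0 : ∀ᵐ x ∂(Measure.haar : Measure G), 0 ≤ h x) {g : LOne G} (hg : integralL G g = 1)
    (φ : BoundedLM G) : ultraMean p x m h (toLinfty (φ - conv g φ)) = 0 := by
  have key : ∀ φ : BoundedLM G, (∀ x, 0 ≤ (φ : G → ℂ) x) →
      ultraMean p x m h (toLinfty φ) = ultraMean p x m h (toLinfty (conv g φ)) := by
    intro φ hφ
    rw [ultraMean_apply, ultraMean_apply,
      ← hm.avg_lconv (isPositive_innerAvg hm h0 (isLocallyNull_of_nonneg hφ)) h hg]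
    refine avg_congr fun a => ?_
    rw [leftTr_lconv, innerAvg_apply, innerAvg_apply]
    exact avg_congr fun b => (limForm_conv p x φ g _ _).symm
  let S : Submodule ℂ (BoundedLM G) :=
    { carrier := {φ | ultraMean p x m h (toLinfty φ) = ultraMean p x m h (toLinfty (conv g φ))}
      zero_mem' := key 0 fun _ => le_rfl
      add_mem' := fun {φ ψ} hφ hψ => by
        simp only [Set.mem_ofPred_eq, conv_add_right, map_add] at *
        rw [hφ, hψ]
      smul_mem' := fun c φ hφ => by
        simp only [Set.mem_ofPred_eq, conv_smul_right, map_smul] at *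
        rw [hφ] }
  rw [map_sub, map_sub, sub_eq_zero]
  exact mem_of_forall_nonneg_mem S key φ

lemma ultraMean_rightAct (hm : IsRightMean m)
    (h0 : ∀ᵐ x ∂(Measure.haar : Measure G), 0 ≤ h x) {g : LOne G} (hg : integralL G g = 1)
    (φ : BoundedLM G) : ultraMean p x m h (toLinfty (φ - rightAct φ g)) = 0 := by
  have key : ∀ φ : BoundedLM G, (∀ x, 0 ≤ (φ : G → ℂ) x) →
      ultraMean p x m h (toLinfty φ) = ultraMean p x m h (toLinfty (rightAct φ g)) := by
    intro φ hφ
    rw [ultraMean_apply, ultraMean_apply]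
    refine avg_congr fun a => ?_
    -- Here g enters the inner average, with a fixed.
    have hpos : IsPositive (limForm p x φ (leftTr a h)) := fun _ hk =>
      limForm_nonneg p x (isLocallyNull_of_nonneg hφ) (leftTr_nonneg a h0) hk
    rw [innerAvg_apply, innerAvg_apply, ← hm.avg_lconv hpos h hg]
    refine avg_congr fun b => ?_
    rw [leftTr_lconv, limForm_rightAct]
  let S : Submodule ℂ (BoundedLM G) :=
    { carrier := {φ | ultraMean p x m h (toLinfty φ) = ultraMean p x m h (toLinfty (rightAct φ g))}
      zero_mem' := key 0 fun _ => le_rfl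
      add_mem' := fun {φ ψ} hφ hψ => by
        simp only [Set.mem_ofPred_eq, rightAct_add_left, map_add] at *
        rw [hφ, hψ]
      smul_mem' := fun c φ hφ => by
        simp only [Set.mem_ofPred_eq, rightAct_smul_left, map_smul] at *
        rw [hφ] }
  rw [map_sub, map_sub, sub_eq_zero]
  exact mem_of_forall_nonneg_mem S key φ

lemma ultraMean_mem_TIM (hm : IsRightMean m) (h1 : integralL G h = 1)
    (h0 : ∀ᵐ x ∂(Measure.haar : Measure G), 0 ≤ h x) : ultraMean p x m h ∈ TIM G := by
  have hg : ∀ g ∈ P1 G, integralL G g = 1 := fun g hg => by rw [integralL_apply, hg.2]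
  exact ⟨⟨isMean_ultraMean hm h1 h0, fun φ g hgP => ultraMean_conv hm h0 (hg g hgP) φ⟩,
    ⟨isMean_ultraMean hm h1 h0, fun φ g hgP => ultraMean_rightAct hm h0 (hg g hgP) φ⟩⟩

end Means

end

end TopInvMean

namespace TopInvMean

open scoped BoundedContinuousFunction Pointwise

universe u

noncomputable section

variable {G : Type u} [Group G] [TopologicalSpace G] [IsTopologicalGroup G] [T2Space G]
  [LocallyCompactSpace G] [MeasurableSpace G] [BorelSpace G]

/-! ### The lower bound -/

variable (G) in
/-- There is a nonnegative function of integral one vanishing off a compact set. -/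
lemma exists_compactSupport_density :
    ∃ (h : LOne G) (V : Set G), IsCompact V ∧ integralL G h = 1 ∧
      (∀ᵐ x ∂(Measure.haar : Measure G), 0 ≤ h x) ∧
      ∀ᵐ x ∂(Measure.haar : Measure G), x ∉ V → h x = 0 := by
  obtain ⟨V, hV, hV1⟩ := exists_compact_mem_nhds (1 : G)
  have hfin : (Measure.haar : Measure G) V ≠ ⊤ := hV.measure_lt_top.ne
  have hpos : 0 < (Measure.haar : Measure G).real V :=
    ENNReal.toReal_pos (Measure.measure_pos_of_mem_nhds _ hV1).ne' hfin
  set c : ℝ := ((Measure.haar : Measure G).real V)⁻¹ with hc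
  refine ⟨indicatorConstLp 1 hV.measurableSet hfin (c : ℂ), V, hV, ?_, ?_, ?_⟩
  · rw [integralL_apply, integral_indicatorConstLp, hc]
    rw [Complex.real_smul, ← Complex.ofReal_mul, mul_inv_cancel₀ hpos.ne', Complex.ofReal_one]
  · filter_upwards [indicatorConstLp_coeFn (p := 1) (hs := hV.measurableSet) (hμs := hfin)
      (c := (c : ℂ))] with x hx
    rw [hx]
    refine Set.indicator_nonneg (fun _ _ => ?_) x
    exact_mod_cast (inv_pos.2 hpos).le
  · exact indicatorConstLp_coeFn_notMem

/-- The indicator function of an open set. -/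
def indicatorOpen {O : Set G} (hO : IsOpen O) : BoundedLM G :=
  ⟨O.indicator fun _ => 1,
    fun _ hK => (measurable_const.indicator hO.measurableSet).indicator hK.measurableSet, 1,
    fun x => (norm_indicator_le_norm_self _ _).trans (by simp)⟩

lemma indicatorOpen_of_mem {O : Set G} (hO : IsOpen O) {y : G} (hy : y ∈ O) :
    (indicatorOpen hO : G → ℂ) y = 1 := Set.indicator_of_mem hy fun _ => (1 : ℂ)

lemma indicatorOpen_of_notMem {O : Set G} (hO : IsOpen O) {y : G} (hy : y ∉ O) :
    (indicatorOpen hO : G → ℂ) y = 0 := Set.indicator_of_notMem hy fun _ => (1 : ℂ)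

/-- The lower bound for the number of two-sided invariant means. -/
theorem two_power_le_mk_TIM (hG : IsAmenable G) (hκ : 1 < compactCoveringNumber G) :
    (2 : Cardinal.{u}) ^ (2 : Cardinal.{u}) ^ compactCoveringNumber G ≤ #(TIM G) := by
  obtain ⟨m, hm⟩ := hG.exists_isRightMean
  obtain ⟨h, S, hS, h1, h0, hsupp⟩ := exists_compactSupport_density G
  obtain ⟨J, K, U, hJ, hK, hU, hUK, hcov⟩ := exists_open_cover (G := G)
  have hinf : Infinite J := by
    rw [Cardinal.infinite_iff, hJ]
    exact aleph0_le_compactCoveringNumber hκ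
  have hI : #(Finset J × Finset (Finset J)) = compactCoveringNumber G := by
    rw [Cardinal.mk_prod, Cardinal.lift_id, Cardinal.lift_id, Cardinal.mk_finset_of_infinite,
      Cardinal.mk_finset_of_infinite, Cardinal.mk_finset_of_infinite,
      Cardinal.mul_eq_self (Cardinal.infinite_iff.1 hinf), hJ]
  set K' : Finset J × Finset (Finset J) → Set G := fun i => ⋃ j ∈ i.1, K j with hK'
  set U' : Finset J × Finset (Finset J) → Set G := fun i => ⋃ j ∈ i.1, U j with hU'
  have hU'o : ∀ i, IsOpen (U' i) := fun i => isOpen_biUnion fun j _ => hU j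
  have hUK' : ∀ i, U' i ⊆ K' i := fun i => Set.iUnion₂_mono fun j _ => hUK j
  obtain ⟨x, hx⟩ := exists_pairwise_disjoint_translates hI K' fun i =>
    i.1.isCompact_biUnion fun j _ => hK j
  have hdisj : ∀ i j, i ≠ j → Disjoint (U' i * {x i} * U' i) (U' j * {x j} * U' j) := fun i j hij =>
    (hx hij).mono (Set.mul_subset_mul (Set.mul_subset_mul_right (hUK' i)) (hUK' i))
      (Set.mul_subset_mul (Set.mul_subset_mul_right (hUK' j)) (hUK' j))
  have htail : ∀ a b : G, ∃ A : Finset J, ∀ i, i ∈ tailSet A → ∀ s ∈ S, ∀ t ∈ S,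
      s⁻¹ * (a⁻¹ * x i) * b * t ∈ U' i * {x i} * U' i := by
    intro a b
    -- One compact set contains both outer factors s⁻¹a⁻¹ and bt; a finite subcover of it is the
    -- required tail A.
    have hC : IsCompact (S⁻¹ * {a⁻¹} ∪ {b} * S) :=
      (hS.inv.mul isCompact_singleton).union (isCompact_singleton.mul hS)
    obtain ⟨A, hA⟩ := hC.elim_finite_subcover U hU (by simp [hcov])
    refine ⟨A, fun i hi s hs t ht => ?_⟩
    have hAU : ⋃ j ∈ A, U j ⊆ U' i := Set.biUnion_subset_biUnion_left hi
    refine ⟨s⁻¹ * a⁻¹ * x i, ⟨s⁻¹ * a⁻¹, hAU (hA (Or.inl ?_)), x i, rfl, rfl⟩, b * t,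
      hAU (hA (Or.inr ?_)), ?_⟩
    · exact ⟨s⁻¹, Set.inv_mem_inv.2 hs, a⁻¹, rfl, rfl⟩
    · exact ⟨b, rfl, t, ht, rfl⟩
    · group
  refine (hJ ▸ two_power_le_mk_ultrafilter J).trans ?_
  refine Cardinal.mk_le_of_injective
    (f := fun p => ⟨ultraMean p.1 x m h, ultraMean_mem_TIM hm h1 h0⟩) fun p q hpq => ?_
  have hpq' : ultraMean p.1 x m h = ultraMean q.1 x m h := congrArg Subtype.val hpq
  by_contra hne
  -- Inclusion between ultrafilters is equality.
  obtain ⟨A, hAp, hAq⟩ : ∃ A, A ∈ p.1 ∧ A ∉ q.1 := by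
    by_contra! hcon
    exact hne (Subtype.ext (Ultrafilter.coe_le_coe.1 hcon).symm)
  -- The separating function is the indicator of this set: by disjointness the sample points
  -- belonging to i lie in it exactly when i ∈ A, for i far enough along the tails.
  have hO : IsOpen (⋃ i ∈ A, U' i * {x i} * U' i) :=
    isOpen_biUnion fun i _ => (hU'o i).mul_left
  have e1 : ultraMean p.1 x m h (toLinfty (indicatorOpen hO)) = 1 := by
    refine ultraMean_eq_of_eventually hm h1 hsupp fun a b => ?_
    obtain ⟨B, hB⟩ := htail a b
    filter_upwards [hAp, p.2 B] with i hiA hiB s hs t ht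
    exact indicatorOpen_of_mem hO (Set.mem_iUnion₂.2 ⟨i, hiA, hB i hiB s hs t ht⟩)
  have e2 : ultraMean q.1 x m h (toLinfty (indicatorOpen hO)) = 0 := by
    refine ultraMean_eq_of_eventually hm h1 hsupp fun a b => ?_
    obtain ⟨B, hB⟩ := htail a b
    filter_upwards [Ultrafilter.compl_mem_iff_notMem.2 hAq, q.2 B] with i hiA hiB s hs t ht
    have hnot : s⁻¹ * (a⁻¹ * x i) * b * t ∉ ⋃ i ∈ A, U' i * {x i} * U' i := by
      intro hmem
      obtain ⟨j, hjA, hj⟩ := Set.mem_iUnion₂.1 hmem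
      have hij : i ≠ j := fun hij => hiA (hij ▸ hjA)
      exact Set.disjoint_left.1 (hdisj i j hij) (hB i hiB s hs t ht) hj
    exact indicatorOpen_of_notMem hO hnot
  rw [hpq', e2] at e1
  exact zero_ne_one e1

/-! ### The upper bound -/

/-- The orbit of an element of `L_1(G)` has density at most `κ(G)`. -/
lemma exists_dense_orbit (hκ : ℵ₀ ≤ compactCoveringNumber G) (f : LOne G) :
    ∃ D : Set G, #D ≤ compactCoveringNumber G ∧
      ∀ x : G, leftTr x f ∈ closure ((fun y => leftTr y f) '' D) := by
  obtain ⟨𝒦, hK, hcov, hcard⟩ := exists_cover G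
  have hex : ∀ K : 𝒦, ∃ D : Set G, D.Countable ∧
      ∀ x ∈ (K : Set G), leftTr x f ∈ closure ((fun y => leftTr y f) '' D) := by
    intro K
    have hsep := ((hK K K.2).image (continuous_leftTr f)).isSeparable
    obtain ⟨t, hts, htc, hcl⟩ := hsep.exists_countable_dense_subset
    -- One preimage for each point of the countable dense set t, so D is itself countable.
    obtain ⟨D, -, hD⟩ := Set.SurjOn.exists_bijOn_subset (f := fun y => leftTr y f)
      (s := (K : Set G)) (t := t) hts
    refine ⟨D, hD.mapsTo.countable_of_injOn hD.injOn htc, fun x hx => ?_⟩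
    rw [hD.image_eq]
    exact hcl ⟨x, hx, rfl⟩
  choose D hDc hD using hex
  refine ⟨⋃ K, D K, ?_, fun x => ?_⟩
  · refine (Cardinal.mk_iUnion_le _).trans ?_
    rw [hcard]
    refine (mul_le_mul_right (ciSup_le' fun K => ?_) _).trans (Cardinal.mul_aleph0_eq hκ).le
    exact (hDc K).le_aleph0
  · obtain ⟨K, hKK, hx⟩ := hcov.symm ▸ Set.mem_univ x
    exact closure_mono (Set.image_mono (Set.subset_iUnion D ⟨K, hKK⟩)) (hD ⟨K, hKK⟩ x hx)

/-- The value of f * φ at x depends continuously on the translate of f by x⁻¹, so the values at the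
inverses of a dense set D of translation parameters determine f * φ. There are at most (2^ℵ₀)^κ =
2^κ choices of such values. -/
lemma mk_range_conv_le (hκ : ℵ₀ ≤ compactCoveringNumber G) (f : LOne G) :
    #(Set.range (conv f)) ≤ (2 : Cardinal.{u}) ^ compactCoveringNumber G := by
  obtain ⟨D, hDc, hD⟩ := exists_dense_orbit hκ f
  have hinj : Function.Injective
      fun (y : Set.range (conv f)) (d : D) => (y.1 : G → ℂ) (d : G)⁻¹ := by
    rintro ⟨_, φ, rfl⟩ ⟨_, ψ, rfl⟩ h
    refine Subtype.ext ?_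
    ext x
    simp only [conv_apply]
    have hcl : IsClosed {k : LOne G | pairing k (reflect φ) = pairing k (reflect ψ)} :=
      isClosed_eq (continuous_pairing _) (continuous_pairing _)
    refine hcl.closure_subset_iff.2 ?_ (hD x⁻¹)
    rintro _ ⟨d, hd, rfl⟩
    have := congrFun h ⟨d, hd⟩
    simp only [conv_apply, inv_inv] at this
    exact this
  refine (Cardinal.mk_le_of_injective hinj).trans ?_
  rw [Cardinal.mk_arrow, Cardinal.mk_complex, Cardinal.lift_continuum, Cardinal.lift_id',
    ← Cardinal.two_power_aleph0, ← Cardinal.power_mul]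
  refine Cardinal.power_le_power_left two_ne_zero ?_
  exact (mul_le_mul_right hDc _).trans (Cardinal.aleph0_mul_eq hκ).le

/-- The upper bound for the number of left-invariant means. -/
theorem mk_TLIM_le (hκ : ℵ₀ ≤ compactCoveringNumber G) :
    #(TLIM G) ≤ (2 : Cardinal.{u}) ^ (2 : Cardinal.{u}) ^ compactCoveringNumber G := by
  obtain ⟨f, -, -, h1, h0, -⟩ := exists_compactSupport_density G
  have hf : f ∈ P1 G := ⟨h0, by rw [← integralL_apply, h1]⟩
  have hinj : Function.Injective
      fun (n : TLIM G) (y : Set.range (conv f)) => n.1 (toLinfty y.1) := by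
    intro n n' h
    refine Subtype.ext (LinearMap.ext fun φ' => ?_)
    obtain ⟨φ, rfl⟩ := (locallyNullFunctions G).mkQ_surjective φ'
    change n.1 (toLinfty φ) = n'.1 (toLinfty φ)
    have e1 := n.2.2 φ f hf
    have e2 := n'.2.2 φ f hf
    rw [map_sub, map_sub, sub_eq_zero] at e1 e2
    rw [e1, e2]
    exact congrFun h ⟨_, φ, rfl⟩
  refine (Cardinal.mk_le_of_injective hinj).trans ?_
  rw [Cardinal.mk_arrow, Cardinal.mk_complex, Cardinal.lift_continuum, Cardinal.lift_id',
    ← Cardinal.two_power_aleph0, ← Cardinal.power_mul]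
  refine Cardinal.power_le_power_left two_ne_zero ?_
  refine (mul_le_mul_right (mk_range_conv_le hκ f) _).trans (Cardinal.aleph0_mul_eq ?_).le
  exact hκ.trans (Cardinal.cantor _).le

end

end TopInvMean

theorem mainTheorem1 (G : Type*) [Group G] [TopologicalSpace G] [IsTopologicalGroup G]
    [T2Space G] [LocallyCompactSpace G] [MeasurableSpace G] [BorelSpace G]
    (hG : TopInvMean.IsAmenable G) (hκ : 1 < TopInvMean.compactCoveringNumber G) :
    #(TopInvMean.TIM G) = #(TopInvMean.TLIM G) ∧
      #(TopInvMean.TLIM G) = 2 ^ ((2 : Cardinal) ^ TopInvMean.compactCoveringNumber G) := by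
  have hupper := TopInvMean.mk_TLIM_le (TopInvMean.aleph0_le_compactCoveringNumber hκ)
  have hlower := TopInvMean.two_power_le_mk_TIM hG hκ
  have hle : #(TopInvMean.TIM G) ≤ #(TopInvMean.TLIM G) :=
    Cardinal.mk_le_mk_of_subset Set.inter_subset_left
  exact ⟨hle.antisymm (hupper.trans hlower), hupper.antisymm (hlower.trans hle)⟩
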